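/- Let $\mathbb H$ be the quaternions, $\mathbb B=\{q\in\mathbb H:|q|<1\}$, $\mathbb S=\{I\in\mathbb H:\operatorname{Re}I=0,\ |I|=1\}$. For $I\in\mathbb S$ put $\mathbb C_I=\{x+Iy: x,y\in\mathbb R\}$, $\mathbb B_I=\mathbb B\cap\mathbb C_I$, $\mathbb B_I^+=\{x+Iy\in\mathbb B: y\ge 0\}$; let $\lambda$ be Lebesgue (area) measure on $\mathbb C_I$, and write $|E|=\lambda(E)$ for $E\subseteq \mathbb C_I$. For $\alpha\in\mathbb B_I$ and $r\in(0,1)$ let $$\Delta_I(\alpha,r)=\Big\{z\in\mathbb C_I:\ 1-z\bar\alpha\neq 0,\ \Big|\frac{z-\alpha}{1-z\bar\alpha}\Big|<r\Big\}.$$ A function $f:\mathbb B\to\mathbb H$ is slice regular if it is real differentiable and, for every $I\in\mathbb S$, $\big(\frac{\partial}{\partial x}+I\frac{\partial}{\partial y}\big)f(x+Iy)=0$ on $\mathbb B_I$. For $p\in(0,\infty)$ the Bergman space $\mathcal A^p(\mathbb B)$ consists of the slice regular functions $f$ on $\mathbb B$ with $$\|f\|_{\mathcal A^p}=\Big(\sup_{I\in\mathbb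 S}\int_{\mathbb B_I}|f|^p\,d\lambda\Big)^{1/p}<\infty .$$ Let $\mu$ be a finite positive Borel measure on $\mathbb B$. Write $\mu=\mu_{\mathbb R}+\tilde\mu$, where $\mu_{\mathbb R}$ and $\tilde\mu$ are the restrictions of $\mu$ to $\mathbb B\cap\mathbb R$ and to $\mathbb B\setminus\mathbb R$. Let $\nu$ be the Borel measure on $\mathbb S$ given by $\nu(E)=\mu\{x+Iy\in\mathbb B: y>0,\ I\in E\}$, and let $(\tilde\mu_I^+)_{I\in\mathbb S}$ be any disintegration of $\tilde\mu$ over $\nu$: each $\tilde\mu_I^+$ is a Borel probability measure carried by $\mathbb B_I^+$, $I\mapsto\tilde\mu_I^+$ is measurable, and $$\int_{\mathbb B} f\,d\tilde\mu=\int_{\mathbb S}\int_{\mathbb B_I^+}f\,d\tilde\mu_I^+\,d\nu(I)$$ for all measurable $f\ge 0$. Put $\mu_I=\mu_{\mathbb R}+\tilde\mu_I^++\tilde\mu_{-I}^+$, a finite measure on $\mathbb B_I$. The measure $\mu$ (with the chosen disintegration) is called slice Carleson for $\mathcal A^p(\mathbb B)$ if there is a constant $C<\infty$ such that for all $I\in\mathbb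 S$ and all $f\in\mathcal A^p(\mathbb B)$ $$\int_{\mathbb B_I}|f|^p\,d\mu_I\le C\,\|f\|_{\mathcal A^p}^p .$$ **Theorem.** Let $p\in(0,\infty)$ be fixed. (a) For $\mu$, $(\tilde\mu_I^+)_{I\in\mathbb S}$ and $\mu_I$ as above, the following are equivalent: 1. $\mu$ is slice Carleson for $\mathcal A^p(\mathbb B)$. 2. For every $r\in(0,1)$ there is $C_r<\infty$ such that $\mu_I(\Delta_I(\alpha,r))\le C_r\,|\Delta_I(\alpha,r)|$ for all $I\in\mathbb S$ and all $\alpha\in\mathbb B_I$. 3. There are $r\in(0,1)$ and $C_r<\infty$ such that $\mu_I(\Delta_I(\alpha,r))\le C_r\,|\Delta_I(\alpha,r)|$ for all $I\in\mathbb S$ and all $\alpha\in\mathbb B_I$. (b) The same holds on a single slice: let $I\in\mathbb S$ and let $m$ be a finite positive Borel measure on $\mathbb B_I$. The following are equivalent: 1. There is $C<\infty$ such that $\int_{\mathbb B_I}|f|^p\,dm\le C\|f\|_{\mathcal A^p}^p$ for all $f\in\mathcal A^p(\mathbb B)$. 2. For every $r\in(0,1)$ there is $C_r<\infty$ such that $m(\Delta_I(\alpha,r))\le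 C_r\,|\Delta_I(\alpha,r)|$ for all $\alpha\in\mathbb B_I$. 3. There are $r\in(0,1)$ and $C_r<\infty$ such that $m(\Delta_I(\alpha,r))\le C_r\,|\Delta_I(\alpha,r)|$ for all $\alpha\in\mathbb B_I$. -/

import Mathlib

open MeasureTheory
open scoped ENNReal NNReal

noncomputable section

namespace SliceBergman

/-- The skew field of real quaternions, with its Euclidean norm. -/
abbrev Quat : Type := Quaternion ℝ

instance : MeasurableSpace Quat := borel Quat

instance : BorelSpace Quat := ⟨rfl⟩

/-- The open unit ball `𝔹` of the quaternions. -/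
def unitBall : Set Quat := Metric.ball 0 1

/-- The real axis inside the quaternions. -/
def realAxis : Set Quat := Set.range (fun x : ℝ => (x : Quat))

/-- The sphere `𝕊` of imaginary units: purely imaginary quaternions of norm one. -/
def imUnits : Set Quat := {q | q.re = 0 ∧ ‖q‖ = 1}

theorem neg_mem_imUnits {q : Quat} (hq : q ∈ imUnits) : -q ∈ imUnits := by
  refine ⟨?_, ?_⟩
  · simpa using hq.1
  · simpa using hq.2

/-- The antipodal unit `-I`. -/
def antipode (I : imUnits) : imUnits := ⟨-I.1, neg_mem_imUnits I.2⟩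

/-- The point `x + I y`. -/
def slicePoint (I : imUnits) (x y : ℝ) : Quat := (x : Quat) + I.1 * (y : Quat)

/-- The complex plane `ℂ_I = {x + I y : x, y ∈ ℝ}`. -/
def slicePlane (I : imUnits) : Set Quat := {q | ∃ x y : ℝ, q = slicePoint I x y}

/-- `𝔹_I = 𝔹 ∩ ℂ_I`. -/
def sliceBall (I : imUnits) : Set Quat := unitBall ∩ slicePlane I

/-- `𝔹_I^+ = {x + I y ∈ 𝔹 : y ≥ 0}`. -/
def upperSliceBall (I : imUnits) : Set Quat :=
  {q | q ∈ unitBall ∧ ∃ x y : ℝ, 0 ≤ y ∧ q = slicePoint I x y}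

/-- Lebesgue (area) measure on `ℂ_I`, as a measure on the quaternions carried by `ℂ_I`: the image
of Lebesgue measure on `ℂ` under `x + i y ↦ x + I y`. -/
def sliceArea (I : imUnits) : Measure Quat :=
  (volume : Measure ℂ).map (fun w => slicePoint I w.re w.im)

/-- (Left) slice regularity on a set `U`, used for open `U`: `f` is real differentiable on `U` and
`∂f_I/∂x + I ∂f_I/∂y = 0` on `U ∩ ℂ_I` for every imaginary unit `I`. As `f` is real differentiable
at `q`, the partial derivatives of `(x, y) ↦ f (x + I y)` there are the values of the differential
of `f` at the vectors `1` and `I`. -/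
def SliceRegularOn (f : Quat → Quat) (U : Set Quat) : Prop :=
  (∀ q ∈ U, DifferentiableAt ℝ f q) ∧
    ∀ I : imUnits, ∀ q ∈ U ∩ slicePlane I,
      fderiv ℝ f q 1 + I.1 * fderiv ℝ f q I.1 = 0

/-- The Bergman norm `‖f‖_{𝒜^p} = (sup_I ∫_{𝔹_I} |f|^p dλ)^{1/p}`, possibly infinite. -/
def bergmanNorm (p : ℝ) (f : Quat → Quat) : ℝ≥0∞ :=
  (⨆ I : imUnits, ∫⁻ z in sliceBall I, ‖f z‖ₑ ^ p ∂(sliceArea I)) ^ (1 / p)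

/-- Membership in the slice regular Bergman space `𝒜^p(𝔹)`; only the values of `f` on `𝔹`
matter. -/
def MemBergman (p : ℝ) (f : Quat → Quat) : Prop :=
  SliceRegularOn f unitBall ∧ bergmanNorm p f < ∞

/-- `ρ_I(z, α) = |(z - α) / (1 - z ᾱ)|`, to be used where `1 - z ᾱ ≠ 0`. -/
def pseudoDist (z α : Quat) : ℝ := ‖(z - α) * (1 - z * star α)⁻¹‖

/-- The pseudohyperbolic disc `Δ_I(α, r)`. The point `z` with `1 - z ᾱ = 0`, at which the quotient
is not defined, is left out. -/
def pseudoDisc (I : imUnits) (α : Quat) (r : ℝ) : Set Quat :=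
  {z | z ∈ slicePlane I ∧ 1 - z * star α ≠ 0 ∧ pseudoDist z α < r}

/-- A disintegration of the part `μ̃` of `μ` off the real axis along the half-slices: `ν` is the
measure `ν(E) = μ {x + I y ∈ 𝔹 : y > 0, I ∈ E}` on `𝕊`, every `κ I` is a probability measure on
`𝔹_I^+`, depending measurably on `I`, and `∫ f dμ̃ = ∫_𝕊 ∫_{𝔹_I^+} f dκ_I dν(I)`. -/
structure IsSliceDisintegration (μ : Measure Quat) (ν : Measure imUnits)
    (κ : imUnits → Measure Quat) : Prop where
  base_apply : ∀ E : Set imUnits, MeasurableSet E →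
    ν E = μ {q | q ∈ unitBall ∧ ∃ I ∈ E, ∃ x y : ℝ, 0 < y ∧ q = slicePoint I x y}
  measurable_fiber : Measurable κ
  prob_fiber : ∀ I, IsProbabilityMeasure (κ I)
  fiber_carrier : ∀ I, κ I (upperSliceBall I)ᶜ = 0
  lintegral_eq : ∀ f : Quat → ℝ≥0∞, Measurable f →
    ∫⁻ q in unitBall \ realAxis, f q ∂μ = ∫⁻ I, ∫⁻ q, f q ∂(κ I) ∂ν

/-- `μ_I = μ_ℝ + μ̃_I^+ + μ̃_{-I}^+`, where `κ` is the family of fibre measures `μ̃_I^+` and `μ_ℝ`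
is the part of `μ` on `𝔹 ∩ ℝ`. -/
def sliceMeasure (μ : Measure Quat) (κ : imUnits → Measure Quat) (I : imUnits) : Measure Quat :=
  μ.restrict (unitBall ∩ realAxis) + κ I + κ (antipode I)

/-- The Carleson inequality on the slice `𝔹_I` with constant `C`, for a measure `m` on `𝔹_I`:
`∫_{𝔹_I} |f|^p dm ≤ C ‖f‖^p` for all `f ∈ 𝒜^p(𝔹)`. -/
def CarlesonBoundOnSlice (p : ℝ) (I : imUnits) (m : Measure Quat) (C : ℝ≥0) : Prop :=
  ∀ f : Quat → Quat, MemBergman p f →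
    ∫⁻ z in sliceBall I, ‖f z‖ₑ ^ p ∂m ≤ C * bergmanNorm p f ^ p

/-- `m(Δ_I(α, r)) ≤ C |Δ_I(α, r)|` for all `α ∈ 𝔹_I`. -/
def DiscBoundOnSlice (I : imUnits) (m : Measure Quat) (r : ℝ) (C : ℝ≥0) : Prop :=
  ∀ α ∈ sliceBall I, m (pseudoDisc I α r) ≤ C * sliceArea I (pseudoDisc I α r)

/-- `μ`, with fibre measures `κ`, is slice Carleson for `𝒜^p(𝔹)`: the Carleson inequality holds for
`μ_I` on every slice `𝔹_I`, with a constant that does not depend on `f` or `I`. -/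
def IsSliceCarleson (p : ℝ) (μ : Measure Quat) (κ : imUnits → Measure Quat) : Prop :=
  ∃ C : ℝ≥0, ∀ I : imUnits, CarlesonBoundOnSlice p I (sliceMeasure μ κ I) C

end SliceBergman

end

open SliceBergman

/-! Both parts rest on two implications for a single slice (`exists_discBound_of_carlesonBound`,
`exists_carlesonBound_of_discBound`). Their constants depend only on `p`, `r` and the given
constant, not on `I` or the measure, so (a) is (b) applied uniformly to all `μ_I`. One radius gives
the Carleson bound, and that bound gives every radius.

Disc bound to Carleson bound: a slice regular function, multiplied on the right by a constant and
projected to `ℂ_I`, is holomorphic on the slice. Hence `|f|` has the sub-mean value property there,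
and `|f|^p` has it up to a constant for every `p > 0` (`exists_rpow_submean`). So `|f(z)|^p` is
controlled by its mean over a disc of radius comparable to `1 - |z|`. Integrating in `m` and
exchanging the integrals leaves the factor `m(Δ(w, r)) / (1 - |w|)²`, bounded because `|Δ(w, r)|` is
comparable to `(1 - |w|)²`.

Carleson bound to disc bound: the test function is the regular power `(1 - q ᾱ)^{-*N}` with `N p >
2`. On `ℂ_I` it is `(1 - w ā)^{-N}`, of size at least a constant times `(1 - |a|)^{-N}` on `Δ(a,
r)`. The Bergman norm sees all slices, but the values on any slice are bounded by those at `w` and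
`w̄` on `ℂ_I` (`norm_sum_sliceHom_mul_le`). The `p`-th power of the norm is therefore at most a
constant times `(1 - |a|)^{2 - Np}`, and the powers combine to `(1 - |a|)²`. -/

open SliceBergman

namespace SliceBergman

/-! ### Sub-mean value inequalities in the plane -/

/-- Area version of the sub-mean value property, obtained by integrating over circles. -/
theorem area_submean {g : ℂ → ℝ} (hg0 : ∀ z, 0 ≤ g z) (hgm : Measurable g) {w : ℂ} {R : ℝ}
    (hR : 0 < R) (hgc : ContinuousOn g (Metric.ball w R))
    (hav : ∀ ρ, 0 < ρ → ρ < R → g w ≤ Real.circleAverage g w ρ) :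
    ENNReal.ofReal (g w * (Real.pi * R ^ 2)) ≤
      ∫⁻ z in Metric.ball w R, ENNReal.ofReal (g z) := by
  set h : ℂ → ℝ≥0∞ := (Metric.ball w R).indicator (fun z => ENNReal.ofReal (g z)) with hh
  have hhm : Measurable h := (hgm.ennreal_ofReal).indicator measurableSet_ball
  have e1 : ∫⁻ z in Metric.ball w R, ENNReal.ofReal (g z) = ∫⁻ u, h (u + w) := by
    rw [lintegral_add_right_eq_self h w, hh, lintegral_indicator measurableSet_ball]
  rw [e1, ← Complex.lintegral_comp_polarCoord_symm]
  have hsm : Measurable (fun p : ℝ × ℝ => Complex.polarCoord.symm p) := by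
    simp only [Complex.polarCoord_symm_apply]
    fun_prop
  have hpt : Measurable fun p : ℝ × ℝ =>
      ENNReal.ofReal p.1 • h (Complex.polarCoord.symm p + w) := by
    simp only [smul_eq_mul]
    exact (measurable_fst.ennreal_ofReal).mul (hhm.comp (hsm.add_const w))
  rw [polarCoord_target, Measure.volume_eq_prod,
    setLIntegral_prod _ hpt.aemeasurable]
  have key : ∀ ρ ∈ Set.Ioi (0 : ℝ), (Set.Ioo 0 R).indicator
      (fun ρ => ENNReal.ofReal (ρ * (2 * Real.pi * g w))) ρ ≤
      ∫⁻ θ in Set.Ioo (-Real.pi) Real.pi,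
        ENNReal.ofReal ρ • h (Complex.polarCoord.symm (ρ, θ) + w) := by
    intro ρ hρ
    by_cases hρR : ρ ∈ Set.Ioo 0 R
    swap
    · rw [Set.indicator_of_notMem hρR]
      exact zero_le
    rw [Set.indicator_of_mem hρR]
    have hcm : ∀ θ : ℝ, Complex.polarCoord.symm (ρ, θ) + w = circleMap w ρ θ := by
      intro θ
      rw [Complex.polarCoord_symm_apply, circleMap, Complex.exp_mul_I, add_comm]
      simp
    have hin : ∀ θ, circleMap w ρ θ ∈ Metric.ball w R := by
      intro θ
      simp [circleMap, abs_of_pos hρR.1, hρR.2]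
    have hval : ∀ θ, h (Complex.polarCoord.symm (ρ, θ) + w) =
        ENNReal.ofReal (g (circleMap w ρ θ)) := by
      intro θ
      rw [hcm, hh, Set.indicator_of_mem (hin θ)]
    have hcont : Continuous fun θ => g (circleMap w ρ θ) :=
      hgc.comp_continuous (continuous_circleMap w ρ) hin
    simp only [hval, smul_eq_mul]
    rw [lintegral_const_mul _ hcont.measurable.ennreal_ofReal, ENNReal.ofReal_mul hρR.1.le]
    gcongr
    rw [← ofReal_integral_eq_lintegral_ofReal]
    · apply ENNReal.ofReal_le_ofReal
      have h1 := hav ρ hρR.1 hρR.2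
      -- The circle average is over `(0, 2π)`; shifting it by periodicity matches the angular range
      -- `(-π, π)` of polar coordinates.
      rw [Real.circleAverage_eq_integral_add (-Real.pi), smul_eq_mul,
        intervalIntegral.integral_comp_add_right (fun θ => g (circleMap w ρ θ)),
        intervalIntegral.integral_of_le (by linarith [Real.pi_pos]),
        integral_Ioc_eq_integral_Ioo] at h1
      have e : 2 * Real.pi + -Real.pi = Real.pi := by ring
      rw [e, zero_add] at h1
      rw [inv_mul_eq_div, le_div_iff₀ (by positivity)] at h1
      linarith
    · exact (hcont.integrableOn_Icc (a := -Real.pi) (b := Real.pi)).mono_set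
        Set.Ioo_subset_Icc_self
    · exact Filter.Eventually.of_forall fun θ => hg0 _
  refine le_trans ?_ (setLIntegral_mono' measurableSet_Ioi key)
  rw [lintegral_indicator measurableSet_Ioo, Measure.restrict_restrict measurableSet_Ioo,
    Set.inter_eq_left.2 (fun x hx => hx.1)]
  rw [← ofReal_integral_eq_lintegral_ofReal]
  · apply ENNReal.ofReal_le_ofReal
    rw [← integral_Ioc_eq_integral_Ioo, ← intervalIntegral.integral_of_le hR.le,
      intervalIntegral.integral_mul_const, integral_id]
    apply le_of_eq
    ring
  · exact ((continuous_id.mul continuous_const).integrableOn_Icc (a := 0) (b := R)).mono_set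
        Set.Ioo_subset_Icc_self
  · refine (ae_restrict_iff' measurableSet_Ioo).2 (Filter.Eventually.of_forall fun ρ hρ => ?_)
    have := hg0 w
    have := hρ.1
    positivity

/-- A continuous function with the sub-mean value property on discs has the `L^p` sub-mean value
property, up to a constant, for `1 ≤ p`. -/
theorem rpow_submean_of_one_le {p : ℝ} (hp : 1 ≤ p) {g : ℂ → ℝ} (hg0 : ∀ z, 0 ≤ g z)
    {w : ℂ} {R : ℝ} (hR : 0 < R)
    (hsub : ENNReal.ofReal (g w * (Real.pi * R ^ 2)) ≤
      ∫⁻ z in Metric.ball w R, ENNReal.ofReal (g z)) :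
    ENNReal.ofReal (g w ^ p * R ^ 2) ≤
      ENNReal.ofReal (2 ^ p / Real.pi) *
        ∫⁻ z in Metric.ball w R, ENNReal.ofReal (g z ^ p) := by
  have hp0 : 0 < p := by linarith
  rcases (hg0 w).eq_or_lt with hz | hpos
  · rw [← hz, Real.zero_rpow hp0.ne']
    simp
  by_cases hX : ∫⁻ z in Metric.ball w R, ENNReal.ofReal (g z ^ p) = ∞
  · rw [hX, ENNReal.mul_top]
    · exact le_top
    · simp only [ne_eq, ENNReal.ofReal_eq_zero, not_le]
      positivity
  set X := (∫⁻ z in Metric.ball w R, ENNReal.ofReal (g z ^ p)).toReal with hXd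
  have hX0 : 0 ≤ X := ENNReal.toReal_nonneg
  have hXe : ∫⁻ z in Metric.ball w R, ENNReal.ofReal (g z ^ p) = ENNReal.ofReal X :=
    (ENNReal.ofReal_toReal hX).symm
  set G := g w with hG
  -- Where `g > G / 2`, `g^{1-p} ≤ (G/2)^{1-p}` because `1 - p ≤ 0`. After integration the term `G /
  -- 2` is half of the left side of `hsub` and is absorbed.
  have pt : ∀ z, g z ≤ G / 2 + (G / 2) ^ (1 - p) * g z ^ p := by
    intro z
    have hG2 : 0 < G / 2 := by positivity
    by_cases hz : g z ≤ G / 2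
    · have : 0 ≤ (G / 2) ^ (1 - p) * g z ^ p :=
        mul_nonneg (Real.rpow_nonneg hG2.le _) (Real.rpow_nonneg (hg0 z) _)
      linarith
    · push Not at hz
      have hgz : 0 < g z := hG2.trans hz
      have h1 : g z = g z ^ (1 - p) * g z ^ p := by
        rw [← Real.rpow_add hgz]; simp
      have h2 : g z ^ (1 - p) ≤ (G / 2) ^ (1 - p) :=
        Real.rpow_le_rpow_of_nonpos hG2 hz.le (by linarith)
      have h3 : g z ^ (1 - p) * g z ^ p ≤ (G / 2) ^ (1 - p) * g z ^ p :=
        mul_le_mul_of_nonneg_right h2 (Real.rpow_nonneg (hg0 z) _)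
      linarith
  have hle : ENNReal.ofReal (G * (Real.pi * R ^ 2)) ≤
      ENNReal.ofReal (G / 2 * (Real.pi * R ^ 2) + (G / 2) ^ (1 - p) * X) := by
    refine hsub.trans ?_
    calc ∫⁻ z in Metric.ball w R, ENNReal.ofReal (g z)
        ≤ ∫⁻ z in Metric.ball w R, (ENNReal.ofReal (G / 2) +
            ENNReal.ofReal ((G / 2) ^ (1 - p)) * ENNReal.ofReal (g z ^ p)) := by
          refine lintegral_mono fun z => ?_
          rw [← ENNReal.ofReal_mul (by positivity),
            ← ENNReal.ofReal_add (by positivity)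
              (mul_nonneg (by positivity) (Real.rpow_nonneg (hg0 z) _))]
          exact ENNReal.ofReal_le_ofReal (pt z)
      _ = _ := by
          rw [lintegral_add_left measurable_const, lintegral_const_mul' _ _ ENNReal.ofReal_ne_top,
            hXe, setLIntegral_const, Complex.volume_ball, ← ENNReal.ofReal_pow hR.le,
            ← ENNReal.ofReal_coe_nnreal, NNReal.coe_real_pi, ← ENNReal.ofReal_mul (by positivity),
            ← ENNReal.ofReal_mul (by positivity), ← ENNReal.ofReal_mul (by positivity),
            ← ENNReal.ofReal_add (by positivity) (by positivity)]
          congr 1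
          ring
  rw [ENNReal.ofReal_le_ofReal_iff (by positivity)] at hle
  rw [hXe, ← ENNReal.ofReal_mul (by positivity)]
  apply ENNReal.ofReal_le_ofReal
  have hG2 : 0 < G / 2 := by positivity
  have h4 : G / 2 * (Real.pi * R ^ 2) ≤ (G / 2) ^ (1 - p) * X := by linarith
  have h5 : (G / 2) ^ (p - 1) * (G / 2 * (Real.pi * R ^ 2)) ≤
      (G / 2) ^ (p - 1) * ((G / 2) ^ (1 - p) * X) :=
    mul_le_mul_of_nonneg_left h4 (by positivity)
  have h6 : (G / 2) ^ (p - 1) * (G / 2) ^ (1 - p) = 1 := by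
    rw [← Real.rpow_add hG2]; simp
  have h7 : (G / 2) ^ (p - 1) * (G / 2) = (G / 2) ^ p := by
    nth_rewrite 2 [← Real.rpow_one (G / 2)]
    rw [← Real.rpow_add hG2]; simp
  rw [← mul_assoc, h7, ← mul_assoc ((G / 2) ^ (p - 1)), h6, one_mul, ← mul_assoc, Real.div_rpow hpos.le (by norm_num)] at h5
  have h2p : (0 : ℝ) < 2 ^ p := by positivity
  rw [div_mul_eq_mul_div, le_div_iff₀ Real.pi_pos]
  rw [div_mul_eq_mul_div, div_mul_eq_mul_div, div_le_iff₀ h2p] at h5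
  linarith

/-- The `L^p` sub-mean value property for `p ≤ 1`: the supremum of
`g u * (R - |u - w|) ^ (2 / p)` is attained and is estimated through a smaller disc. -/
theorem rpow_submean_of_le_one {p : ℝ} (hp0 : 0 < p) (hp : p ≤ 1) {g : ℂ → ℝ}
    (hg0 : ∀ z, 0 ≤ g z) {w : ℂ} {R : ℝ} (hR : 0 < R)
    (hgc : ContinuousOn g (Metric.closedBall w R))
    (hsub : ∀ u ρ, 0 < ρ → Metric.ball u ρ ⊆ Metric.ball w R →
      ENNReal.ofReal (g u * (Real.pi * ρ ^ 2)) ≤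
        ∫⁻ z in Metric.ball u ρ, ENNReal.ofReal (g z)) :
    ENNReal.ofReal (g w ^ p * R ^ 2) ≤
      ENNReal.ofReal (2 ^ (2 / p) / Real.pi) *
        ∫⁻ z in Metric.ball w R, ENNReal.ofReal (g z ^ p) := by
  have h2p : 0 < 2 / p := by positivity
  rcases (hg0 w).eq_or_lt with hz | hpos
  · rw [← hz, Real.zero_rpow hp0.ne']
    simp
  by_cases hX : ∫⁻ z in Metric.ball w R, ENNReal.ofReal (g z ^ p) = ∞
  · rw [hX, ENNReal.mul_top]
    · exact le_top
    · simp only [ne_eq, ENNReal.ofReal_eq_zero, not_le]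
      positivity
  set X := (∫⁻ z in Metric.ball w R, ENNReal.ofReal (g z ^ p)).toReal with hXd
  have hX0 : 0 ≤ X := ENNReal.toReal_nonneg
  have hXe : ∫⁻ z in Metric.ball w R, ENNReal.ofReal (g z ^ p) = ENNReal.ofReal X :=
    (ENNReal.ofReal_toReal hX).symm
  -- The exponent `2 / p` makes the `p`-th power of the weight quadratic, like `R ^ 2` in the claim.
  -- The weight vanishes on the boundary, so the maximum is attained inside.
  have hcont : ContinuousOn (fun u => g u * (R - dist u w) ^ (2 / p))
      (Metric.closedBall w R) := by
    refine hgc.mul (ContinuousOn.rpow_const (by fun_prop) fun _ _ => Or.inr h2p.le)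
  obtain ⟨w0, hw0, hmax⟩ := (isCompact_closedBall w R).exists_isMaxOn
    ⟨w, Metric.mem_closedBall_self hR.le⟩ hcont
  have hmax' : ∀ u ∈ Metric.closedBall w R,
      g u * (R - dist u w) ^ (2 / p) ≤ g w0 * (R - dist w0 w) ^ (2 / p) := fun u hu => hmax hu
  set M := g w0 * (R - dist w0 w) ^ (2 / p) with hM
  have hwM : g w * R ^ (2 / p) ≤ M := by
    simpa using hmax' w (Metric.mem_closedBall_self hR.le)
  have hM0 : 0 < M := lt_of_lt_of_le (by positivity) hwM
  have hd : dist w0 w < R := by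
    rcases (Metric.mem_closedBall.1 hw0).eq_or_lt with h | h
    · rw [hM, h, sub_self, Real.zero_rpow h2p.ne', mul_zero] at hM0
      exact absurd hM0 (lt_irrefl _)
    · exact h
  -- With half the distance to the boundary as radius, the weight drops by at most `2 ^ (2 / p)` on
  -- the small disc, so maximality gives `g ≤ T = 2 ^ (2 / p) * g w0` there.
  set ρ := (R - dist w0 w) / 2 with hρ
  have hρ0 : 0 < ρ := by rw [hρ]; linarith
  have hR2 : R - dist w0 w = 2 * ρ := by rw [hρ]; ring
  have hball : Metric.ball w0 ρ ⊆ Metric.ball w R :=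
    Metric.ball_subset_ball' (by linarith)
  set T := M / ρ ^ (2 / p) with hT
  have hT0 : 0 < T := by positivity
  have hTρ : T * ρ ^ (2 / p) = M := by
    rw [hT]; field_simp
  have hgT : ∀ u ∈ Metric.ball w0 ρ, g u ≤ T := by
    intro u hu
    have h1 := hmax' u (Metric.ball_subset_closedBall (hball hu))
    have h2 : ρ ≤ R - dist u w := by
      have := dist_triangle u w0 w
      have := Metric.mem_ball.1 hu
      linarith
    rw [hT, le_div_iff₀ (by positivity)]
    refine le_trans ?_ h1
    exact mul_le_mul_of_nonneg_left (Real.rpow_le_rpow hρ0.le h2 h2p.le) (hg0 u)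
  have hgw0 : g w0 * 2 ^ (2 / p) = T := by
    rw [hT, hM, hR2, Real.mul_rpow (by norm_num) hρ0.le]
    field_simp
  -- On the small disc `g = g^{1-p} g^p ≤ T^{1-p} g^p`, since `1 - p ≥ 0`.
  have hle : ENNReal.ofReal (g w0 * (Real.pi * ρ ^ 2)) ≤ ENNReal.ofReal (T ^ (1 - p) * X) := by
    refine (hsub w0 ρ hρ0 hball).trans ?_
    rw [ENNReal.ofReal_mul (by positivity), ← hXe,
      ← lintegral_const_mul' _ _ ENNReal.ofReal_ne_top]
    refine le_trans (setLIntegral_mono' measurableSet_ball fun u hu => ?_)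
      (lintegral_mono_set hball)
    rw [← ENNReal.ofReal_mul (by positivity)]
    apply ENNReal.ofReal_le_ofReal
    rcases (hg0 u).eq_or_lt with hz | hu0
    · rw [← hz, Real.zero_rpow hp0.ne', mul_zero]
    · have h1 : g u = g u ^ (1 - p) * g u ^ p := by
        rw [← Real.rpow_add hu0]; simp
      have h2 : g u ^ (1 - p) ≤ T ^ (1 - p) :=
        Real.rpow_le_rpow hu0.le (hgT u hu) (by linarith)
      calc g u = g u ^ (1 - p) * g u ^ p := h1
        _ ≤ _ := mul_le_mul_of_nonneg_right h2 (Real.rpow_nonneg (hg0 u) _)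
  rw [ENNReal.ofReal_le_ofReal_iff (by positivity)] at hle
  have hK : (0 : ℝ) < 2 ^ (2 / p) := by positivity
  have hTp : T ^ (1 - p) * T ^ p = T := by
    rw [← Real.rpow_add hT0]; simp
  have h8 : T ^ p * ρ ^ 2 * Real.pi ≤ 2 ^ (2 / p) * X := by
    have h9 : T ^ (1 - p) * (T ^ p * ρ ^ 2 * Real.pi) ≤ T ^ (1 - p) * (2 ^ (2 / p) * X) := by
      calc T ^ (1 - p) * (T ^ p * ρ ^ 2 * Real.pi) = T * (Real.pi * ρ ^ 2) := by
            linear_combination (ρ ^ 2 * Real.pi) * hTp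
        _ = 2 ^ (2 / p) * (g w0 * (Real.pi * ρ ^ 2)) := by rw [← hgw0]; ring
        _ ≤ 2 ^ (2 / p) * (T ^ (1 - p) * X) := mul_le_mul_of_nonneg_left hle hK.le
        _ = _ := by ring
    exact le_of_mul_le_mul_left h9 (by positivity)
  have hpow : ∀ x : ℝ, 0 ≤ x → (x ^ (2 / p)) ^ p = x ^ 2 := by
    intro x hx
    rw [← Real.rpow_mul hx, div_mul_cancel₀ _ hp0.ne', Real.rpow_two]
  have h10 : g w ^ p * R ^ 2 ≤ T ^ p * ρ ^ 2 := by
    rw [← hpow R hR.le, ← hpow ρ hρ0.le, ← Real.mul_rpow (hg0 w) (by positivity),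
      ← Real.mul_rpow hT0.le (by positivity), hTρ]
    exact Real.rpow_le_rpow (by positivity) hwM hp0.le
  rw [hXe, ← ENNReal.ofReal_mul (by positivity)]
  apply ENNReal.ofReal_le_ofReal
  rw [div_mul_eq_mul_div, le_div_iff₀ Real.pi_pos]
  exact le_trans (mul_le_mul_of_nonneg_right h10 Real.pi_pos.le) h8

/-! ### Slices as isometric copies of the complex plane -/

theorem imUnit_mul_self (I : imUnits) : I.1 * I.1 = -1 := by
  obtain ⟨hre, hn⟩ := I.2
  have hs : star I.1 = -I.1 := Quaternion.star_eq_neg.2 hre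
  have h := Quaternion.self_mul_star I.1
  rw [hs, Quaternion.normSq_eq_norm_mul_self, hn] at h
  rw [mul_neg] at h
  rw [← neg_neg (I.1 * I.1), h]
  simp

/-- The embedding `x + i y ↦ x + I y` of `ℂ` into the quaternions, as an algebra homomorphism. -/
noncomputable def sliceHom (I : imUnits) : ℂ →ₐ[ℝ] Quat :=
  Complex.liftAux I.1 (imUnit_mul_self I)

theorem sliceHom_apply (I : imUnits) (w : ℂ) :
    sliceHom I w = (w.re : Quat) + w.im • I.1 := by
  rw [sliceHom, Complex.liftAux_apply]
  rfl

theorem slicePoint_eq (I : imUnits) (x y : ℝ) : slicePoint I x y = sliceHom I ⟨x, y⟩ := by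
  rw [slicePoint, sliceHom_apply]
  simp only [← Quaternion.coe_mul_eq_smul]
  rw [Quaternion.coe_commutes]

theorem slicePlane_eq (I : imUnits) : slicePlane I = Set.range (sliceHom I) := by
  ext q
  constructor
  · rintro ⟨x, y, rfl⟩
    exact ⟨⟨x, y⟩, (slicePoint_eq I x y).symm⟩
  · rintro ⟨w, rfl⟩
    exact ⟨w.re, w.im, by rw [slicePoint_eq]⟩

theorem sliceHom_I (I : imUnits) : sliceHom I Complex.I = I.1 := by
  simp [sliceHom_apply]

theorem star_sliceHom (I : imUnits) (w : ℂ) :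
    star (sliceHom I w) = sliceHom I (starRingEnd ℂ w) := by
  have hs : star I.1 = -I.1 := Quaternion.star_eq_neg.2 I.2.1
  rw [sliceHom_apply, sliceHom_apply, star_add, Quaternion.star_smul, hs]
  simp

theorem norm_sliceHom (I : imUnits) (w : ℂ) : ‖sliceHom I w‖ = ‖w‖ := by
  have h : (‖sliceHom I w‖ * ‖sliceHom I w‖ : ℝ) = ‖w‖ * ‖w‖ := by
    rw [← Quaternion.normSq_eq_norm_mul_self, ← sq ‖w‖, ← Complex.normSq_eq_norm_sq]
    have h1 := Quaternion.self_mul_star (sliceHom I w)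
    rw [star_sliceHom, ← map_mul, Complex.mul_conj, sliceHom_apply] at h1
    simp only [Complex.ofReal_re, Complex.ofReal_im, zero_smul, add_zero] at h1
    exact (Quaternion.coe_injective h1).symm
  nlinarith [norm_nonneg (sliceHom I w), norm_nonneg w, mul_self_inj (norm_nonneg (sliceHom I w)) (norm_nonneg w)]

theorem isometry_sliceHom (I : imUnits) : Isometry (sliceHom I) :=
  AddMonoidHomClass.isometry_of_norm _ (norm_sliceHom I)

theorem measurableEmbedding_sliceHom (I : imUnits) : MeasurableEmbedding (sliceHom I) :=
  (isometry_sliceHom I).isClosedEmbedding.measurableEmbedding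

/-- The embedding of `ℂ` as a continuous linear map. -/
noncomputable def sliceCLM (I : imUnits) : ℂ →L[ℝ] Quat :=
  LinearMap.toContinuousLinearMap (sliceHom I).toLinearMap

theorem sliceCLM_apply (I : imUnits) (w : ℂ) : sliceCLM I w = sliceHom I w := rfl

theorem sliceHom_mem_unitBall {I : imUnits} {w : ℂ} :
    sliceHom I w ∈ unitBall ↔ w ∈ Metric.ball (0 : ℂ) 1 := by
  simp [unitBall, norm_sliceHom]

theorem sliceBall_eq (I : imUnits) : sliceBall I = sliceHom I '' Metric.ball 0 1 := by
  rw [sliceBall, slicePlane_eq]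
  ext q
  constructor
  · rintro ⟨hq, w, rfl⟩
    exact ⟨w, sliceHom_mem_unitBall.1 hq, rfl⟩
  · rintro ⟨w, hw, rfl⟩
    exact ⟨sliceHom_mem_unitBall.2 hw, w, rfl⟩

theorem sliceArea_eq (I : imUnits) : sliceArea I = (volume : Measure ℂ).map (sliceHom I) := by
  rw [sliceArea]
  congr 1
  ext w : 1
  rw [slicePoint_eq]

theorem measurableSet_sliceBall (I : imUnits) : MeasurableSet (sliceBall I) := by
  rw [sliceBall_eq]
  exact (measurableEmbedding_sliceHom I).measurableSet_image.2 measurableSet_ball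

/-- Integrals over `𝔹_I` are integrals over the unit disc of `ℂ`. -/
theorem lintegral_sliceBall (I : imUnits) (m : Measure Quat) (F : Quat → ℝ≥0∞) :
    ∫⁻ z in sliceBall I, F z ∂m =
      ∫⁻ w in Metric.ball 0 1, F (sliceHom I w) ∂(m.comap (sliceHom I)) := by
  have he := measurableEmbedding_sliceHom I
  rw [← he.lintegral_map, ← Set.preimage_image_eq (Metric.ball (0 : ℂ) 1)
    (isometry_sliceHom I).injective, ← sliceBall_eq, ← he.restrict_map, he.map_comap,
    Measure.restrict_restrict (measurableSet_sliceBall I), Set.inter_eq_left.2]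
  rw [← slicePlane_eq]
  exact Set.inter_subset_right

theorem comap_sliceArea (I : imUnits) : (sliceArea I).comap (sliceHom I) = volume := by
  rw [sliceArea_eq, (measurableEmbedding_sliceHom I).comap_map]

/-- The pseudohyperbolic disc in the complex plane. -/
def complexDisc (a : ℂ) (r : ℝ) : Set ℂ :=
  {w | ‖w - a‖ < r * ‖1 - w * starRingEnd ℂ a‖}

/-- Clearing the denominator loses nothing: where it vanishes, the strict inequality would put a
norm below zero, so that point is left out on both sides. -/
theorem pseudoDisc_eq (I : imUnits) (a : ℂ) (r : ℝ) :
    pseudoDisc I (sliceHom I a) r = sliceHom I '' complexDisc a r := by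
  have key : ∀ w : ℂ, (1 - sliceHom I w * star (sliceHom I a) ≠ 0 ∧
      pseudoDist (sliceHom I w) (sliceHom I a) < r) ↔ w ∈ complexDisc a r := by
    intro w
    have e1 : 1 - sliceHom I w * star (sliceHom I a) =
        sliceHom I (1 - w * starRingEnd ℂ a) := by
      rw [star_sliceHom, map_sub, map_mul, map_one]
    rw [pseudoDist, e1, ← map_sub, ← map_inv₀, ← map_mul, norm_sliceHom, norm_mul, norm_inv,
      map_ne_zero, complexDisc, Set.mem_ofPred_eq, ← div_eq_mul_inv]
    constructor
    · rintro ⟨h0, h⟩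
      exact (div_lt_iff₀ (norm_pos_iff.2 h0)).1 h
    · intro h
      have h0 : 1 - w * starRingEnd ℂ a ≠ 0 := by
        rintro h0
        rw [h0, norm_zero, mul_zero] at h
        exact absurd h (not_lt.2 (norm_nonneg _))
      exact ⟨h0, (div_lt_iff₀ (norm_pos_iff.2 h0)).2 h⟩
  ext q
  simp only [pseudoDisc, slicePlane_eq, Set.mem_ofPred_eq]
  constructor
  · rintro ⟨⟨w, rfl⟩, h⟩
    exact ⟨w, (key w).1 h, rfl⟩
  · rintro ⟨w, hw, rfl⟩
    exact ⟨⟨w, rfl⟩, (key w).2 hw⟩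

theorem discBoundOnSlice_iff (I : imUnits) (m : Measure Quat) (r : ℝ) (C : ℝ≥0) :
    DiscBoundOnSlice I m r C ↔ ∀ a ∈ Metric.ball (0 : ℂ) 1,
      m.comap (sliceHom I) (complexDisc a r) ≤ C * volume (complexDisc a r) := by
  have he := measurableEmbedding_sliceHom I
  rw [DiscBoundOnSlice, sliceBall_eq, Set.forall_mem_image]
  refine forall₂_congr fun a _ => ?_
  rw [pseudoDisc_eq I a r, ← comap_sliceArea I, he.comap_apply, he.comap_apply]

theorem carlesonBoundOnSlice_iff {p : ℝ} (hp : 0 < p) (I : imUnits) (m : Measure Quat)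
    (C : ℝ≥0) :
    CarlesonBoundOnSlice p I m C ↔ ∀ f : Quat → Quat, MemBergman p f →
      ∫⁻ w in Metric.ball 0 1, ‖f (sliceHom I w)‖ₑ ^ p ∂(m.comap (sliceHom I)) ≤
        C * ⨆ J : imUnits, ∫⁻ w in Metric.ball 0 1, ‖f (sliceHom J w)‖ₑ ^ p := by
  rw [CarlesonBoundOnSlice]
  refine forall₂_congr fun f _ => ?_
  rw [lintegral_sliceBall, bergmanNorm, one_div, ENNReal.rpow_inv_rpow hp.ne']
  simp only [lintegral_sliceBall, comap_sliceArea]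

/-! ### Euclidean size of pseudohyperbolic discs -/

section DiscGeometry

variable {a w : ℂ} {r : ℝ}

theorem one_sub_le_norm_one_sub_mul (hw : ‖w‖ ≤ 1) :
    1 - ‖a‖ ≤ ‖1 - w * starRingEnd ℂ a‖ := by
  have h := norm_sub_norm_le (1 : ℂ) (w * starRingEnd ℂ a)
  rw [norm_mul, RCLike.norm_conj, norm_one] at h
  nlinarith [norm_nonneg a, norm_nonneg w]

/-- The identity behind the disc automorphisms: for `|a| < 1`, the sign of the difference tells on
which side of the unit circle `w` lies. -/
theorem normSq_one_sub_mul_sub (a w : ℂ) :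
    ‖1 - w * starRingEnd ℂ a‖ ^ 2 - ‖w - a‖ ^ 2 = (1 - ‖a‖ ^ 2) * (1 - ‖w‖ ^ 2) := by
  simp only [← Complex.normSq_eq_norm_sq, Complex.normSq_apply, Complex.sub_re, Complex.sub_im,
    Complex.mul_re, Complex.mul_im, Complex.conj_re, Complex.conj_im, Complex.one_re,
    Complex.one_im]
  ring

theorem norm_sub_le_norm_one_sub_mul (ha : ‖a‖ ≤ 1) (hw : ‖w‖ ≤ 1) :
    ‖w - a‖ ≤ ‖1 - w * starRingEnd ℂ a‖ := by
  have h := normSq_one_sub_mul_sub a w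
  have h1 : 0 ≤ (1 - ‖a‖ ^ 2) * (1 - ‖w‖ ^ 2) :=
    mul_nonneg (by nlinarith [norm_nonneg a]) (by nlinarith [norm_nonneg w])
  exact (sq_le_sq₀ (norm_nonneg _) (norm_nonneg _)).1 (by linarith)

/-- The mean of two lower bounds. It replaces the kernel by a radial function about `a`, whose
integral over the plane is found by scaling. -/
theorem half_add_le_norm_one_sub_mul (ha : ‖a‖ ≤ 1) (hw : ‖w‖ ≤ 1) :
    (1 - ‖a‖ + ‖w - a‖) / 2 ≤ ‖1 - w * starRingEnd ℂ a‖ := by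
  linarith [one_sub_le_norm_one_sub_mul (a := a) hw, norm_sub_le_norm_one_sub_mul ha hw]

theorem complexDisc_subset_ball (ha : ‖a‖ < 1) (hr1 : r ≤ 1) :
    complexDisc a r ⊆ Metric.ball 0 1 := by
  intro w hw
  rw [complexDisc, Set.mem_ofPred_eq] at hw
  have h := normSq_one_sub_mul_sub a w
  have h1 : ‖w - a‖ < ‖1 - w * starRingEnd ℂ a‖ :=
    lt_of_lt_of_le hw (mul_le_of_le_one_left (norm_nonneg _) hr1)
  have h2 : ‖w - a‖ ^ 2 < ‖1 - w * starRingEnd ℂ a‖ ^ 2 :=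
    (sq_lt_sq₀ (norm_nonneg _) (norm_nonneg _)).2 h1
  have h3 : 0 < 1 - ‖a‖ ^ 2 := by nlinarith [norm_nonneg a]
  have h4 : 0 < 1 - ‖w‖ ^ 2 := by
    by_contra hc
    nlinarith
  rw [mem_ball_zero_iff]
  nlinarith [norm_nonneg w]

theorem one_sub_mul_eq (a w : ℂ) :
    1 - w * starRingEnd ℂ a = ((1 - ‖a‖ ^ 2 : ℝ) : ℂ) - (w - a) * starRingEnd ℂ a := by
  have h := Complex.mul_conj a
  rw [Complex.normSq_eq_norm_sq] at h
  push_cast at h ⊢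
  rw [← h]
  ring

theorem norm_one_sub_mul_le_add (ha : ‖a‖ ≤ 1) :
    ‖1 - w * starRingEnd ℂ a‖ ≤ 2 * (1 - ‖a‖) + ‖w - a‖ := by
  rw [one_sub_mul_eq]
  refine (norm_sub_le _ _).trans ?_
  rw [norm_mul, RCLike.norm_conj, Complex.norm_real, Real.norm_eq_abs,
    abs_of_nonneg (by nlinarith [norm_nonneg a])]
  nlinarith [norm_nonneg a, norm_nonneg (w - a)]

/-- On the disc `|w - a| < r |1 - w ā|`, so the last term of `norm_one_sub_mul_le_add` is absorbed
at the cost of the factor `1 / (1 - r)`. -/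
theorem norm_one_sub_mul_le_of_mem (ha : ‖a‖ ≤ 1) (hr1 : r < 1)
    (hw : w ∈ complexDisc a r) : ‖1 - w * starRingEnd ℂ a‖ ≤ 2 / (1 - r) * (1 - ‖a‖) := by
  rw [complexDisc, Set.mem_ofPred_eq] at hw
  have h := norm_one_sub_mul_le_add (w := w) ha
  rw [div_mul_eq_mul_div, le_div_iff₀ (by linarith)]
  linarith

theorem complexDisc_subset_ball_center (ha : ‖a‖ ≤ 1) (hr1 : r < 1) :
    complexDisc a r ⊆ Metric.ball a (2 / (1 - r) * (1 - ‖a‖)) := by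
  intro w hw
  have h := norm_one_sub_mul_le_of_mem ha hr1 hw
  rw [complexDisc, Set.mem_ofPred_eq] at hw
  rw [mem_ball_iff_norm]
  have : r * ‖1 - w * starRingEnd ℂ a‖ ≤ ‖1 - w * starRingEnd ℂ a‖ :=
    mul_le_of_le_one_left (norm_nonneg _) hr1.le
  linarith

theorem ball_subset_complexDisc (ha : ‖a‖ ≤ 1) (hr0 : 0 < r) (hr1 : r ≤ 1) :
    Metric.ball a (r / 2 * (1 - ‖a‖)) ⊆ complexDisc a r := by
  intro w hw
  rw [mem_ball_iff_norm] at hw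
  rw [complexDisc, Set.mem_ofPred_eq]
  have h : 1 - ‖a‖ - ‖w - a‖ ≤ ‖1 - w * starRingEnd ℂ a‖ := by
    rw [one_sub_mul_eq]
    refine le_trans ?_ (norm_sub_norm_le _ _)
    rw [norm_mul, RCLike.norm_conj, Complex.norm_real, Real.norm_eq_abs,
      abs_of_nonneg (by nlinarith [norm_nonneg a])]
    nlinarith [norm_nonneg a, norm_nonneg (w - a)]
  have h2 : (1 - ‖a‖) / 2 ≤ ‖1 - w * starRingEnd ℂ a‖ := by nlinarith [norm_nonneg (w - a)]
  nlinarith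

/-- Exchanges centre and point: when `w` is averaged near `z`, the point `z` lies in the disc about
`w`, which is where the hypothesis on the measure can be applied after Tonelli. -/
theorem norm_sub_lt_imp_mem_complexDisc {z : ℂ} (hz : ‖z‖ < 1) (hr0 : 0 < r) (hr1 : r ≤ 1)
    (hzw : ‖w - z‖ < r / 4 * (1 - ‖z‖)) :
    ‖w‖ < 1 ∧ z ∈ complexDisc w r ∧ 1 - ‖w‖ ≤ 2 * (1 - ‖z‖) := by
  have h1 : |‖w‖ - ‖z‖| ≤ ‖w - z‖ := abs_norm_sub_norm_le w z
  rw [abs_le] at h1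
  have h2 : ‖w‖ < 1 := by nlinarith
  refine ⟨h2, ball_subset_complexDisc h2.le hr0 hr1 ?_, by nlinarith⟩
  rw [mem_ball_iff_norm, norm_sub_rev]
  have h3 : (1 - r / 4) * (1 - ‖z‖) ≤ 1 - ‖w‖ := by nlinarith
  have h4 : r / 4 * (1 - ‖z‖) ≤ r / 2 * ((1 - r / 4) * (1 - ‖z‖)) := by
    have : 0 ≤ r * (1 - ‖z‖) * (1 - r / 2) :=
      mul_nonneg (mul_nonneg hr0.le (by linarith)) (by linarith)
    nlinarith
  have h5 : r / 2 * ((1 - r / 4) * (1 - ‖z‖)) ≤ r / 2 * (1 - ‖w‖) :=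
    mul_le_mul_of_nonneg_left h3 (by linarith)
  linarith

end DiscGeometry

theorem volume_complexDisc_le {a : ℂ} (ha : ‖a‖ < 1) {r : ℝ} (hr1 : r < 1) :
    volume (complexDisc a r) ≤
      ENNReal.ofReal (Real.pi * (2 / (1 - r)) ^ 2 * (1 - ‖a‖) ^ 2) := by
  refine (measure_mono (complexDisc_subset_ball_center ha.le hr1)).trans ?_
  have : 0 < 1 - r := by linarith
  have : 0 < 1 - ‖a‖ := by linarith
  rw [Complex.volume_ball, ← ENNReal.ofReal_pow (by positivity), ← ENNReal.ofReal_coe_nnreal,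
    NNReal.coe_real_pi, ← ENNReal.ofReal_mul (by positivity)]
  exact ENNReal.ofReal_le_ofReal (le_of_eq (by ring))

theorem le_volume_complexDisc {a : ℂ} (ha : ‖a‖ < 1) {r : ℝ} (hr0 : 0 < r) (hr1 : r ≤ 1) :
    ENNReal.ofReal (Real.pi * (r / 2) ^ 2 * (1 - ‖a‖) ^ 2) ≤ volume (complexDisc a r) := by
  refine le_trans ?_ (measure_mono (ball_subset_complexDisc ha.le hr0 hr1))
  have : 0 < 1 - ‖a‖ := by linarith
  rw [Complex.volume_ball, ← ENNReal.ofReal_pow (by positivity), ← ENNReal.ofReal_coe_nnreal,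
    NNReal.coe_real_pi, ← ENNReal.ofReal_mul (by positivity)]
  exact ENNReal.ofReal_le_ofReal (le_of_eq (by ring))

/-! ### Test functions: regular powers and their Bergman norms -/

theorem exists_eq_sliceHom (I : imUnits) (q : Quat) : ∃ (J : imUnits) (w : ℂ), q = sliceHom J w := by
  by_cases h : q.im = 0
  · refine ⟨I, q.re, ?_⟩
    rw [sliceHom_apply]
    simpa [h] using (Quaternion.re_add_im q).symm
  · have hn : ‖q.im‖ ≠ 0 := norm_ne_zero_iff.2 h
    refine ⟨⟨‖q.im‖⁻¹ • q.im, by simp, ?_⟩, ⟨q.re, ‖q.im‖⟩, ?_⟩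
    · rw [norm_smul, norm_inv, norm_norm, inv_mul_cancel₀ hn]
    · rw [sliceHom_apply, smul_smul, mul_inv_cancel₀ hn, one_smul, Quaternion.re_add_im]

/-- A form of the representation formula. The sum on slice `J` is `A + J B` with `A`, `B`
independent of `J`; the two sums on slice `I` are `A + I B` and `A - I B`, so `|A|` and `|B|` are
each at most half the right side. -/
theorem norm_sum_sliceHom_mul_le {ι : Type*} (s : Finset ι) (G : ι → ℂ) (c : ι → Quat)
    (I J : imUnits) :
    ‖∑ k ∈ s, sliceHom J (G k) * c k‖ ≤ ‖∑ k ∈ s, sliceHom I (G k) * c k‖ +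
      ‖∑ k ∈ s, sliceHom I (starRingEnd ℂ (G k)) * c k‖ := by
  set A : Quat := ∑ k ∈ s, (G k).re • c k with hA
  set B : Quat := ∑ k ∈ s, (G k).im • c k with hB
  have e1 : ∀ J : imUnits, ∑ k ∈ s, sliceHom J (G k) * c k = A + J.1 * B := by
    intro J
    rw [hA, hB, Finset.mul_sum, ← Finset.sum_add_distrib]
    refine Finset.sum_congr rfl fun k _ => ?_
    rw [sliceHom_apply, add_mul, Quaternion.coe_mul_eq_smul, smul_mul_assoc, mul_smul_comm]
  have e2 : ∑ k ∈ s, sliceHom I (starRingEnd ℂ (G k)) * c k = A - I.1 * B := by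
    rw [hA, hB, Finset.mul_sum, ← Finset.sum_sub_distrib]
    refine Finset.sum_congr rfl fun k _ => ?_
    rw [sliceHom_apply, add_mul, Complex.conj_re, Complex.conj_im, Quaternion.coe_mul_eq_smul,
      smul_mul_assoc, mul_smul_comm, neg_smul, ← sub_eq_add_neg]
  rw [e1, e1, e2]
  have hu : ∀ (J : imUnits) (x : Quat), ‖J.1 * x‖ = ‖x‖ := fun J x => by
    rw [norm_mul, J.2.2, one_mul]
  have h1 : 2 * ‖A‖ ≤ ‖A + I.1 * B‖ + ‖A - I.1 * B‖ := by
    have h := norm_add_le (A + I.1 * B) (A - I.1 * B)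
    rw [show A + I.1 * B + (A - I.1 * B) = (2 : ℝ) • A by rw [two_smul]; abel, norm_smul] at h
    simpa using h
  have h2 : 2 * ‖B‖ ≤ ‖A + I.1 * B‖ + ‖A - I.1 * B‖ := by
    have h := norm_sub_le (A + I.1 * B) (A - I.1 * B)
    rw [show A + I.1 * B - (A - I.1 * B) = (2 : ℝ) • (I.1 * B) by rw [two_smul]; abel,
      norm_smul, hu] at h
    simpa using h
  have h3 := norm_add_le A (J.1 * B)
  rw [hu] at h3
  linarith

/-- The real polynomial `(1 - a w) (1 - ā w)`. -/
noncomputable def symmPoly (a w : ℂ) : ℂ := 1 - (2 * a.re) • w + (‖a‖ ^ 2) • w ^ 2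

/-- The coefficient functions of the test functions: holomorphic with real Taylor coefficients. -/
noncomputable def kernelCoeff (N : ℕ) (a : ℂ) (k : ℕ) (w : ℂ) : ℂ :=
  (symmPoly a w)⁻¹ ^ N * (-w) ^ k

/-- The regular power `(1 - q ᾱ)^{-*N}`, for `α` the image of `a` in `ℂ_I`. -/
noncomputable def regularKernel (N : ℕ) (a : ℂ) (I : imUnits) (q : Quat) : Quat :=
  ∑ k ∈ Finset.range (N + 1),
    ((1 - (2 * a.re) • q + (‖a‖ ^ 2) • q ^ 2)⁻¹ ^ N * (-q) ^ k) * sliceHom I (a ^ k * N.choose k)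

theorem symmPoly_eq_mul (a w : ℂ) :
    symmPoly a w = (1 - w * a) * (1 - w * starRingEnd ℂ a) := by
  have h1 := Complex.mul_conj a
  rw [Complex.normSq_eq_norm_sq] at h1
  have h2 := Complex.add_conj a
  rw [symmPoly, Complex.real_smul, Complex.real_smul, ← h1, ← h2]
  ring

theorem one_sub_mul_conj_ne_zero {a w : ℂ} (ha : ‖a‖ < 1) (hw : ‖w‖ ≤ 1) :
    1 - w * starRingEnd ℂ a ≠ 0 := by
  have h := one_sub_le_norm_one_sub_mul (a := a) hw
  exact norm_pos_iff.1 (by linarith)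

theorem symmPoly_ne_zero {a w : ℂ} (ha : ‖a‖ < 1) (hw : ‖w‖ ≤ 1) : symmPoly a w ≠ 0 := by
  rw [symmPoly_eq_mul]
  refine mul_ne_zero ?_ (one_sub_mul_conj_ne_zero ha hw)
  have h := one_sub_mul_conj_ne_zero (a := starRingEnd ℂ a) (w := w) (by simpa using ha) hw
  simpa using h

theorem sliceHom_symmPoly (J : imUnits) (a w : ℂ) :
    sliceHom J (symmPoly a w) =
      1 - (2 * a.re) • sliceHom J w + (‖a‖ ^ 2) • sliceHom J w ^ 2 := by
  rw [symmPoly, map_add, map_sub, map_one, map_smul, map_smul, map_pow]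

theorem regularKernel_sliceHom (N : ℕ) (a : ℂ) (I J : imUnits) (w : ℂ) :
    regularKernel N a I (sliceHom J w) = ∑ k ∈ Finset.range (N + 1),
      sliceHom J (kernelCoeff N a k w) * sliceHom I (a ^ k * N.choose k) := by
  rw [regularKernel]
  simp only [← sliceHom_symmPoly, kernelCoeff, map_mul, map_pow, map_inv₀, map_neg]

/-- On its own slice all factors commute; the binomial theorem sums the coefficients to `(1 - w
a)^N`, which cancels one factor of `symmPoly`. -/
theorem regularKernel_sliceHom_self {N : ℕ} {a : ℂ} (ha : ‖a‖ < 1) (I : imUnits) {w : ℂ}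
    (hw : ‖w‖ ≤ 1) :
    regularKernel N a I (sliceHom I w) = sliceHom I ((1 - w * starRingEnd ℂ a)⁻¹ ^ N) := by
  have h1 : 1 - w * a ≠ 0 := fun h => symmPoly_ne_zero ha hw (by rw [symmPoly_eq_mul, h, zero_mul])
  have h2 : 1 - w * starRingEnd ℂ a ≠ 0 := one_sub_mul_conj_ne_zero ha hw
  rw [regularKernel_sliceHom]
  simp only [← map_mul]
  rw [← map_sum]
  congr 1
  have h3 : ∑ k ∈ Finset.range (N + 1), kernelCoeff N a k w * (a ^ k * N.choose k) =
      (symmPoly a w)⁻¹ ^ N * (1 - w * a) ^ N := by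
    rw [show (1 - w * a) = (-w * a) + 1 by ring, add_pow, Finset.mul_sum]
    refine Finset.sum_congr rfl fun k _ => ?_
    rw [kernelCoeff, mul_pow, one_pow]
    ring
  rw [h3, symmPoly_eq_mul, ← mul_pow]
  congr 1
  field_simp

/-- Identifies the conjugated sum in `norm_sum_sliceHom_mul_le` with the kernel at `w̄`. -/
theorem kernelCoeff_conj (N : ℕ) (a : ℂ) (k : ℕ) (w : ℂ) :
    kernelCoeff N a k (starRingEnd ℂ w) = starRingEnd ℂ (kernelCoeff N a k w) := by
  simp [kernelCoeff, symmPoly, Complex.conj_ofNat]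

theorem norm_regularKernel_le {N : ℕ} {a : ℂ} (ha : ‖a‖ < 1) (I J : imUnits) {w : ℂ}
    (hw : ‖w‖ ≤ 1) : ‖regularKernel N a I (sliceHom J w)‖ ≤
      ‖1 - w * starRingEnd ℂ a‖⁻¹ ^ N + ‖1 - w * a‖⁻¹ ^ N := by
  have h := norm_sum_sliceHom_mul_le (Finset.range (N + 1)) (fun k => kernelCoeff N a k w)
    (fun k => sliceHom I (a ^ k * N.choose k)) I J
  simp only [← kernelCoeff_conj, ← regularKernel_sliceHom] at h
  rw [regularKernel_sliceHom_self ha I hw, regularKernel_sliceHom_self ha I (by simpa using hw),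
    norm_sliceHom, norm_sliceHom, norm_pow, norm_pow, norm_inv, norm_inv, ← map_mul,
    ← RCLike.norm_conj (1 - starRingEnd ℂ (w * a))] at h
  simpa using h

/-- In each summand the left factor is holomorphic on every slice and the constant stands on the
right, where it does not disturb the Cauchy–Riemann operator acting from the left. -/
theorem regularKernel_sliceRegularOn (N : ℕ) {a : ℂ} (ha : ‖a‖ < 1) (I : imUnits) :
    SliceRegularOn (regularKernel N a I) unitBall := by
  have hdiff : ∀ q ∈ unitBall, DifferentiableAt ℝ (regularKernel N a I) q := by
    intro q hq
    obtain ⟨J, w, rfl⟩ := exists_eq_sliceHom I q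
    have hw := (mem_ball_zero_iff.1 (sliceHom_mem_unitBall.1 hq)).le
    have hs : 1 - (2 * a.re) • sliceHom J w + (‖a‖ ^ 2) • sliceHom J w ^ 2 ≠ 0 := by
      rw [← sliceHom_symmPoly, map_ne_zero]
      exact symmPoly_ne_zero ha hw
    unfold regularKernel
    have hs' : DifferentiableAt ℝ (fun q : Quat =>
        1 - (2 * a.re) • q + (‖a‖ ^ 2) • q ^ 2) (sliceHom J w) := by fun_prop
    refine DifferentiableAt.fun_sum fun k _ => ?_
    exact (((hs'.fun_inv hs).fun_pow N).fun_mul (differentiableAt_id.fun_neg.fun_pow k)).mul_const _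
  refine ⟨hdiff, ?_⟩
  rintro J q ⟨hq, hqJ⟩
  rw [slicePlane_eq] at hqJ
  obtain ⟨w, rfl⟩ := hqJ
  have hw := (mem_ball_zero_iff.1 (sliceHom_mem_unitBall.1 hq)).le
  have hG : ∀ k, DifferentiableAt ℂ (kernelCoeff N a k) w := by
    intro k
    have hs' : DifferentiableAt ℂ (symmPoly a) w := by
      unfold symmPoly
      simp only [Complex.real_smul]
      fun_prop
    exact ((hs'.fun_inv (symmPoly_ne_zero ha hw)).fun_pow N).fun_mul
      (differentiableAt_id.fun_neg.fun_pow k)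
  have h1 : HasFDerivAt (fun w => regularKernel N a I (sliceHom J w))
      ((fderiv ℝ (regularKernel N a I) (sliceHom J w)).comp (sliceCLM J)) w := by
    have h : HasFDerivAt (regularKernel N a I) (fderiv ℝ (regularKernel N a I) (sliceHom J w))
      (sliceCLM J w) := (hdiff _ hq).hasFDerivAt
    exact h.comp w (sliceCLM J).hasFDerivAt
  have h2 := HasFDerivAt.fun_sum (u := Finset.range (N + 1)) fun k _ =>
    ((sliceCLM J).hasFDerivAt.comp w
      ((hG k).hasFDerivAt.restrictScalars ℝ)).mul_const' (sliceHom I (a ^ k * N.choose k))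
  simp only [regularKernel_sliceHom] at h1
  have h3 := h1.unique h2
  have e : ∀ v : ℂ, fderiv ℝ (regularKernel N a I) (sliceHom J w) (sliceHom J v) =
      ∑ k ∈ Finset.range (N + 1), sliceHom J (deriv (kernelCoeff N a k) w * v) *
        sliceHom I (a ^ k * N.choose k) := by
    intro v
    have h4 := congrArg (fun T : ℂ →L[ℝ] Quat => T v) h3
    simp only [ContinuousLinearMap.comp_apply, sliceCLM_apply] at h4
    rw [h4, sum_apply]
    refine Finset.sum_congr rfl fun k _ => ?_
    simp only [smul_apply, ContinuousLinearMap.comp_apply, sliceCLM_apply,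
      op_smul_eq_mul, ContinuousLinearMap.coe_restrictScalars']
    rw [fderiv_eq_smul_deriv, smul_eq_mul, mul_comm v]
  have e1 := e 1
  have e2 := e Complex.I
  rw [map_one] at e1
  rw [sliceHom_I] at e2
  rw [e1, e2, Finset.mul_sum, ← Finset.sum_add_distrib]
  refine Finset.sum_eq_zero fun k _ => ?_
  rw [← mul_assoc, ← add_mul, ← sliceHom_I J, ← map_mul, ← map_add]
  have : deriv (kernelCoeff N a k) w * 1 + Complex.I * (deriv (kernelCoeff N a k) w * Complex.I)
      = 0 := by
    linear_combination (deriv (kernelCoeff N a k) w) * Complex.I_mul_I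
  rw [this, map_zero, zero_mul]

/-- The scaling of the integral of `(δ + |w - a|)^{-s}`. -/
theorem lintegral_add_norm_sub_rpow {δ s : ℝ} (hδ : 0 < δ) (a : ℂ) :
    ∫⁻ w : ℂ, ENNReal.ofReal ((δ + ‖w - a‖) ^ (-s)) =
      ENNReal.ofReal (δ ^ (2 - s)) * ∫⁻ w : ℂ, ENNReal.ofReal ((1 + ‖w‖) ^ (-s)) := by
  rw [← lintegral_add_right_eq_self _ a]
  simp only [add_sub_cancel_right]
  have hm : Measurable fun w : ℂ => ENNReal.ofReal ((δ + ‖w‖) ^ (-s)) := by fun_prop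
  have h1 := lintegral_map (μ := (volume : Measure ℂ)) hm (measurable_const_smul δ)
  rw [Measure.map_addHaar_smul _ hδ.ne', lintegral_smul_measure, Complex.finrank_real_complex,
    smul_eq_mul] at h1
  have h2 : ∀ w : ℂ, ENNReal.ofReal ((δ + ‖δ • w‖) ^ (-s)) =
      ENNReal.ofReal (δ ^ (-s)) * ENNReal.ofReal ((1 + ‖w‖) ^ (-s)) := by
    intro w
    rw [norm_smul, Real.norm_eq_abs, abs_of_pos hδ, ← ENNReal.ofReal_mul (by positivity),
      ← Real.mul_rpow hδ.le (by positivity)]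
    congr 2
    ring
  simp only [h2] at h1
  rw [lintegral_const_mul' _ _ ENNReal.ofReal_ne_top] at h1
  have h3 : ENNReal.ofReal (δ ^ 2) * ENNReal.ofReal |(δ ^ 2)⁻¹| = 1 := by
    rw [abs_of_pos (by positivity), ← ENNReal.ofReal_mul (by positivity),
      mul_inv_cancel₀ (by positivity), ENNReal.ofReal_one]
  calc ∫⁻ w : ℂ, ENNReal.ofReal ((δ + ‖w‖) ^ (-s))
      = ENNReal.ofReal (δ ^ 2) * (ENNReal.ofReal |(δ ^ 2)⁻¹| *
          ∫⁻ w : ℂ, ENNReal.ofReal ((δ + ‖w‖) ^ (-s))) := by rw [← mul_assoc, h3, one_mul]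
    _ = _ := by
        rw [h1, ← mul_assoc, ← ENNReal.ofReal_mul (by positivity), sub_eq_add_neg,
          Real.rpow_add hδ, Real.rpow_two]

theorem inv_pow_rpow_le {p x y : ℝ} (hp : 0 < p) (hy : 0 < y) (hxy : y / 2 ≤ x) (N : ℕ) :
    (x⁻¹ ^ N) ^ p ≤ 2 ^ (N * p) * y ^ (-(N * p)) := by
  have hx : 0 < x := by linarith
  rw [← Real.rpow_natCast, ← Real.rpow_mul (by positivity), Real.rpow_neg hy.le,
    ← Real.inv_rpow hy.le, ← Real.mul_rpow (by norm_num) (by positivity)]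
  refine Real.rpow_le_rpow (by positivity) ?_ (by positivity)
  rw [inv_le_comm₀ hx (by positivity), mul_inv, inv_inv]
  linarith

theorem add_rpow_le_mul {p x y : ℝ} (hp : 0 < p) (hx : 0 ≤ x) (hy : 0 ≤ y) :
    (x + y) ^ p ≤ 2 ^ p * (x ^ p + y ^ p) := by
  have hx' := Real.rpow_nonneg hx p
  have hy' := Real.rpow_nonneg hy p
  have h2 : (0 : ℝ) ≤ 2 ^ p := by positivity
  rcases le_total x y with h | h
  · calc (x + y) ^ p ≤ (2 * y) ^ p := Real.rpow_le_rpow (by linarith) (by linarith) hp.le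
      _ = 2 ^ p * y ^ p := Real.mul_rpow (by norm_num) hy
      _ ≤ _ := mul_le_mul_of_nonneg_left (by linarith) h2
  · calc (x + y) ^ p ≤ (2 * x) ^ p := Real.rpow_le_rpow (by linarith) (by linarith) hp.le
      _ = 2 ^ p * x ^ p := Real.mul_rpow (by norm_num) hx
      _ ≤ _ := mul_le_mul_of_nonneg_left (by linarith) h2

/-- The Bergman norm of the test functions. -/
theorem exists_lintegral_regularKernel_le {p : ℝ} (hp : 0 < p) {N : ℕ} (hN : 2 < N * p) :
    ∃ K : ℝ, 0 ≤ K ∧ ∀ (a : ℂ), ‖a‖ < 1 → ∀ I J : imUnits,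
      ∫⁻ w in Metric.ball 0 1, ‖regularKernel N a I (sliceHom J w)‖ₑ ^ p ≤
        ENNReal.ofReal (K * (1 - ‖a‖) ^ (2 - N * p)) := by
  -- `N p > 2`, the real dimension of `ℂ`, is exactly what integrability at infinity requires.
  have hfin : ∫⁻ w : ℂ, ENNReal.ofReal ((1 + ‖w‖) ^ (-(N * p))) < ∞ :=
    finite_integral_one_add_norm (by rw [Complex.finrank_real_complex]; exact_mod_cast hN)
  set X := (∫⁻ w : ℂ, ENNReal.ofReal ((1 + ‖w‖) ^ (-(N * p)))).toReal with hX
  have hX0 : 0 ≤ X := ENNReal.toReal_nonneg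
  have hXe : ∫⁻ w : ℂ, ENNReal.ofReal ((1 + ‖w‖) ^ (-(N * p))) = ENNReal.ofReal X :=
    (ENNReal.ofReal_toReal hfin.ne).symm
  refine ⟨2 ^ p * 2 ^ (N * p) * (2 * X), by positivity, ?_⟩
  intro a ha I J
  have hδ : 0 < 1 - ‖a‖ := by linarith
  have pt : ∀ w ∈ Metric.ball (0 : ℂ) 1, ‖regularKernel N a I (sliceHom J w)‖ₑ ^ p ≤
      ENNReal.ofReal (2 ^ p * 2 ^ (N * p)) *
        (ENNReal.ofReal ((1 - ‖a‖ + ‖w - a‖) ^ (-(N * p))) +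
          ENNReal.ofReal ((1 - ‖a‖ + ‖w - starRingEnd ℂ a‖) ^ (-(N * p)))) := by
    intro w hw
    have hw1 := (mem_ball_zero_iff.1 hw).le
    have ha' : ‖starRingEnd ℂ a‖ ≤ 1 := by simpa using ha.le
    rw [← ofReal_norm, ENNReal.ofReal_rpow_of_nonneg (norm_nonneg _) hp.le,
      ← ENNReal.ofReal_add (by positivity) (by positivity), ← ENNReal.ofReal_mul (by positivity)]
    apply ENNReal.ofReal_le_ofReal
    refine (Real.rpow_le_rpow (norm_nonneg _) (norm_regularKernel_le ha I J hw1) hp.le).trans ?_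
    refine (add_rpow_le_mul hp (by positivity) (by positivity)).trans ?_
    have h1 := inv_pow_rpow_le hp (by positivity) (half_add_le_norm_one_sub_mul ha.le hw1) N
    have h2 := inv_pow_rpow_le hp (by rw [RCLike.norm_conj]; positivity)
      (half_add_le_norm_one_sub_mul ha' hw1) N
    rw [RCLike.norm_conj, Complex.conj_conj] at h2
    rw [mul_assoc]
    refine mul_le_mul_of_nonneg_left ?_ (by positivity)
    linarith
  refine (setLIntegral_mono' measurableSet_ball pt).trans ((setLIntegral_le_lintegral _ _).trans ?_)
  rw [lintegral_const_mul' _ _ ENNReal.ofReal_ne_top, lintegral_add_left (by fun_prop),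
    lintegral_add_norm_sub_rpow hδ, lintegral_add_norm_sub_rpow hδ, hXe,
    ← ENNReal.ofReal_mul (by positivity), ← ENNReal.ofReal_add (by positivity) (by positivity),
    ← ENNReal.ofReal_mul (by positivity)]
  refine ENNReal.ofReal_le_ofReal (le_of_eq ?_)
  ring

theorem memBergman_of_lintegral_le {p : ℝ} (hp : 0 < p) {f : Quat → Quat}
    (hf : SliceRegularOn f unitBall) {K : ℝ}
    (h : ∀ J : imUnits, ∫⁻ w in Metric.ball 0 1, ‖f (sliceHom J w)‖ₑ ^ p ≤ ENNReal.ofReal K) :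
    MemBergman p f := by
  refine ⟨hf, ?_⟩
  rw [bergmanNorm]
  refine ENNReal.rpow_lt_top_of_nonneg (by positivity) (ne_of_lt ?_)
  refine lt_of_le_of_lt (iSup_le fun J => ?_) (ENNReal.ofReal_lt_top (r := K))
  rw [lintegral_sliceBall, comap_sliceArea]
  exact h J

/-! ### From the Carleson inequality to the disc bound -/

theorem exists_discBound_of_carlesonBound {p : ℝ} (hp : 0 < p) {r : ℝ}
    (hr : r ∈ Set.Ioo (0 : ℝ) 1) (C : ℝ≥0) :
    ∃ C' : ℝ≥0, ∀ (I : imUnits) (m : Measure Quat),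
      CarlesonBoundOnSlice p I m C → DiscBoundOnSlice I m r C' := by
  obtain ⟨hr0, hr1⟩ := hr
  obtain ⟨N, hN⟩ := exists_nat_gt (2 / p)
  rw [div_lt_iff₀ hp] at hN
  obtain ⟨K, hK, hint⟩ := exists_lintegral_regularKernel_le hp hN
  have h1r : 0 < 1 - r := by linarith
  -- The first factor bounds the kernel from below on the disc, `C * K` comes from the Carleson
  -- inequality and the norm estimate, and the denominator from the lower area bound. The powers of
  -- `δ` cancel: `δ^{Np} δ^{2-Np} = δ²`.
  set D : ℝ := (2 / (1 - r)) ^ (N * p) * (C * K) / (Real.pi * (r / 2) ^ 2) with hD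
  have hD0 : 0 ≤ D := by positivity
  refine ⟨D.toNNReal, fun I m hcar => ?_⟩
  rw [carlesonBoundOnSlice_iff hp] at hcar
  rw [discBoundOnSlice_iff]
  intro a ha
  have ha1 := mem_ball_zero_iff.1 ha
  have hδ : 0 < 1 - ‖a‖ := by linarith
  set δ := 1 - ‖a‖ with hδd
  set c : ℝ := (2 / (1 - r) * δ) ^ (-(N * p)) with hc
  have hc0 : 0 < c := by positivity
  have hmem := memBergman_of_lintegral_le hp (regularKernel_sliceRegularOn N ha1 I)
    (fun J => hint a ha1 I J)
  have h1 := hcar _ hmem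
  have h2 : (⨆ J : imUnits, ∫⁻ w in Metric.ball 0 1, ‖regularKernel N a I (sliceHom J w)‖ₑ ^ p) ≤
      ENNReal.ofReal (K * δ ^ (2 - N * p)) := iSup_le fun J => hint a ha1 I J
  have hdm : MeasurableSet (complexDisc a r) := by
    refine (isOpen_lt (f := fun x : ℂ => ‖x - a‖)
      (g := fun x : ℂ => r * ‖1 - x * starRingEnd ℂ a‖) (by fun_prop)
      (by fun_prop)).measurableSet
  have h3 : ENNReal.ofReal c * m.comap (sliceHom I) (complexDisc a r) ≤
      ∫⁻ w in Metric.ball 0 1, ‖regularKernel N a I (sliceHom I w)‖ₑ ^ p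
        ∂(m.comap (sliceHom I)) := by
    rw [← setLIntegral_const]
    refine le_trans (setLIntegral_mono' hdm fun w hw => ?_)
      (lintegral_mono_set (complexDisc_subset_ball ha1 hr1.le))
    have hw1 := (mem_ball_zero_iff.1 (complexDisc_subset_ball ha1 hr1.le hw)).le
    have h4 := norm_one_sub_mul_le_of_mem ha1.le hr1 hw
    have h5 := norm_pos_iff.2 (one_sub_mul_conj_ne_zero ha1 hw1)
    rw [regularKernel_sliceHom_self ha1 I hw1, ← ofReal_norm, norm_sliceHom,
      ENNReal.ofReal_rpow_of_nonneg (norm_nonneg _) hp.le]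
    apply ENNReal.ofReal_le_ofReal
    rw [norm_pow, norm_inv, ← Real.rpow_natCast, ← Real.rpow_mul (by positivity),
      Real.inv_rpow h5.le, ← Real.rpow_neg h5.le, hc]
    exact Real.rpow_le_rpow_of_nonpos h5 h4 (by simp; positivity)
  have h6 : m.comap (sliceHom I) (complexDisc a r) ≤
      ENNReal.ofReal (c⁻¹ * (C * (K * δ ^ (2 - N * p)))) := by
    have h7 := h3.trans (h1.trans (mul_le_mul_right h2 _))
    rw [ENNReal.ofReal_mul (by positivity), ENNReal.ofReal_inv_of_pos hc0,
      ENNReal.ofReal_mul (by positivity), ENNReal.ofReal_coe_nnreal]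
    rwa [← ENNReal.div_eq_inv_mul, ENNReal.le_div_iff_mul_le (Or.inl (by simpa using hc0))
      (Or.inl ENNReal.ofReal_ne_top), mul_comm]
  refine h6.trans (le_trans (le_of_eq ?_)
    (mul_le_mul_right (le_volume_complexDisc ha1 hr0 hr1.le) _))
  change _ = ENNReal.ofReal D * _
  rw [← ENNReal.ofReal_mul hD0]
  congr 1
  rw [hc, Real.rpow_neg (by positivity), inv_inv, Real.mul_rpow (by positivity) hδ.le,
    Real.rpow_sub hδ, Real.rpow_two, hD, ← hδd]
  have := Real.pi_pos
  field_simp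

/-! ### Splitting and mean values of slice regular functions -/

/-- The complex coordinate of `q` with respect to the left `ℂ_I`-module structure. -/
noncomputable def sliceProj (I : imUnits) : Quat →L[ℝ] ℂ :=
  LinearMap.toContinuousLinearMap
    { toFun := fun q => ⟨q.re, -(I.1 * q).re⟩
      map_add' := fun q q' => by
        apply Complex.ext
        · simp
        · simp only [mul_add, Quaternion.re_add, Complex.add_im]; ring
      map_smul' := fun c q => by
        apply Complex.ext
        · simp
        · simp only [mul_smul_comm, Quaternion.re_smul, Complex.smul_im, RingHom.id_apply,
            smul_eq_mul, mul_neg] }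

theorem sliceProj_apply (I : imUnits) (q : Quat) :
    sliceProj I q = ⟨q.re, -(I.1 * q).re⟩ := rfl

/-- Complex linearity for left multiplication by `I`: this turns the slice equation into the
Cauchy–Riemann equation of the coordinate. -/
theorem sliceProj_unit_mul (I : imUnits) (q : Quat) :
    sliceProj I (I.1 * q) = Complex.I * sliceProj I q := by
  rw [sliceProj_apply, sliceProj_apply, ← mul_assoc, imUnit_mul_self]
  apply Complex.ext <;> simp

theorem SliceRegularOn.fderiv_unit {f : Quat → Quat} {U : Set Quat} (hf : SliceRegularOn f U)
    {I : imUnits} {q : Quat} (hq : q ∈ U ∩ slicePlane I) :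
    fderiv ℝ f q I.1 = I.1 * fderiv ℝ f q 1 := by
  have h := hf.2 I q hq
  have h2 : I.1 * (fderiv ℝ f q 1 + I.1 * fderiv ℝ f q I.1) = 0 := by rw [h, mul_zero]
  rw [mul_add, ← mul_assoc, imUnit_mul_self, neg_one_mul] at h2
  exact (add_neg_eq_zero.1 h2).symm

/-- Splitting: the complex coordinate of `f b` is holomorphic on a slice, for a constant `b`. -/
theorem SliceRegularOn.differentiableAt_proj {f : Quat → Quat}
    (hf : SliceRegularOn f unitBall) (I : imUnits) (b : Quat) {w : ℂ}
    (hw : w ∈ Metric.ball (0 : ℂ) 1) :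
    DifferentiableAt ℂ (fun w => sliceProj I (f (sliceHom I w) * b)) w := by
  have hq := sliceHom_mem_unitBall (I := I).2 hw
  have h1 : HasFDerivAt f (fderiv ℝ f (sliceCLM I w)) (sliceCLM I w) := (hf.1 _ hq).hasFDerivAt
  have h2 : HasFDerivAt (fun w => f (sliceHom I w)) ((fderiv ℝ f (sliceHom I w)).comp
      (sliceCLM I)) w := h1.comp w (sliceCLM I).hasFDerivAt
  have h3 := (sliceProj I).hasFDerivAt.comp w (h2.mul_const' b)
  change HasFDerivAt (fun w => sliceProj I (f (sliceHom I w) * b)) _ w at h3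
  rw [differentiableAt_complex_iff_differentiableAt_real]
  refine ⟨h3.differentiableAt, ?_⟩
  rw [h3.fderiv]
  have hreg := hf.fderiv_unit (I := I) (q := sliceHom I w) ⟨hq, by
    rw [slicePlane_eq]; exact ⟨w, rfl⟩⟩
  simp only [ContinuousLinearMap.comp_apply, smul_apply,
    sliceCLM_apply, sliceHom_I, map_one, hreg, MulOpposite.smul_eq_mul_unop,
    MulOpposite.unop_op, mul_assoc, sliceProj_unit_mul, smul_eq_mul]

theorem re_le_norm (q : Quat) : q.re ≤ ‖q‖ := by
  have h := Quaternion.normSq_eq_norm_mul_self q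
  rw [Quaternion.normSq_def'] at h
  nlinarith [norm_nonneg q, sq_nonneg q.imI, sq_nonneg q.imJ, sq_nonneg q.imK]

theorem SliceRegularOn.continuousOn_comp {f : Quat → Quat} (hf : SliceRegularOn f unitBall)
    (I : imUnits) : ContinuousOn (fun w => f (sliceHom I w)) (Metric.ball 0 1) := by
  intro w hw
  exact (ContinuousAt.comp (f := sliceHom I) (hf.1 _ (sliceHom_mem_unitBall.2 hw)).continuousAt
    (isometry_sliceHom I).continuous.continuousAt).continuousWithinAt

/-- Duality: `b` has norm at most one and makes `f b` equal to `|f|` at the centre. The real part of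
`f b` is harmonic on the slice and at most `|f|`, so its mean value property gives the claim. -/
theorem SliceRegularOn.norm_le_circleAverage {f : Quat → Quat}
    (hf : SliceRegularOn f unitBall) (I : imUnits) {w : ℂ} {ρ : ℝ}
    (hρ : 0 < ρ) (hw : Metric.closedBall w ρ ⊆ Metric.ball 0 1) :
    ‖f (sliceHom I w)‖ ≤ Real.circleAverage (fun u => ‖f (sliceHom I u)‖) w ρ := by
  set b : Quat := star (f (sliceHom I w)) * ((‖f (sliceHom I w)‖⁻¹ : ℝ) : Quat) with hb
  have habs : |ρ| = ρ := abs_of_pos hρ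
  have hbn : ‖b‖ ≤ 1 := by
    rw [hb, norm_mul, norm_star, Quaternion.norm_coe, norm_inv, norm_norm]
    exact mul_inv_le_one
  have hbw : (f (sliceHom I w) * b).re = ‖f (sliceHom I w)‖ := by
    rw [hb, ← mul_assoc, Quaternion.self_mul_star, ← Quaternion.coe_mul, Quaternion.re_coe,
      Quaternion.normSq_eq_norm_mul_self]
    by_cases h : ‖f (sliceHom I w)‖ = 0
    · simp [h]
    · field_simp
  have hd : DifferentiableOn ℂ (fun w => sliceProj I (f (sliceHom I w) * b))
      (Metric.closedBall w |ρ|) := fun u hu =>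
    (hf.differentiableAt_proj I b (hw (habs ▸ hu))).differentiableWithinAt
  have hsph : Metric.sphere w |ρ| ⊆ Metric.closedBall w |ρ| := Metric.sphere_subset_closedBall
  have hcr : ContinuousOn (fun u => (f (sliceHom I u) * b).re) (Metric.sphere w |ρ|) :=
    Complex.continuous_re.comp_continuousOn (hd.continuousOn.mono hsph)
  have hav : Real.circleAverage (fun u => (f (sliceHom I u) * b).re) w ρ =
      ‖f (sliceHom I w)‖ := by
    have h := (hd.diffContOnCl_ball subset_rfl).circleAverage
    have h2 := Complex.reCLM.circleAverage_comp_comm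
      (hd.continuousOn.mono hsph).circleIntegrable'
    rw [h] at h2
    exact h2.trans hbw
  rw [← hav]
  refine Real.circleAverage_mono hcr.circleIntegrable' ?_ ?_
  · refine ContinuousOn.circleIntegrable' ((hf.continuousOn_comp I).norm.mono ?_)
    rw [habs] at hsph ⊢
    exact hsph.trans hw
  · intro u hu
    refine (re_le_norm _).trans ?_
    rw [norm_mul]
    exact mul_le_of_le_one_right (norm_nonneg _) hbn

/-- The local `L^p` estimate for slice regular functions, for every `p > 0`. -/
theorem exists_rpow_submean {p : ℝ} (hp : 0 < p) : ∃ K : ℝ, 0 ≤ K ∧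
    ∀ (f : Quat → Quat), SliceRegularOn f unitBall → ∀ (I : imUnits) (w : ℂ) (R : ℝ), 0 < R →
      Metric.closedBall w R ⊆ Metric.ball 0 1 →
      ENNReal.ofReal (‖f (sliceHom I w)‖ ^ p * R ^ 2) ≤
        ENNReal.ofReal K * ∫⁻ z in Metric.ball w R, ENNReal.ofReal (‖f (sliceHom I z)‖ ^ p) := by
  have main : ∀ (f : Quat → Quat), SliceRegularOn f unitBall → ∀ (I : imUnits) (w : ℂ) (R : ℝ),
      0 < R → Metric.ball w R ⊆ Metric.ball 0 1 →
      ENNReal.ofReal (‖f (sliceHom I w)‖ * (Real.pi * R ^ 2)) ≤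
        ∫⁻ z in Metric.ball w R, ENNReal.ofReal (‖f (sliceHom I z)‖) := by
    intro f hf I w R hR hsub
    have hc := (hf.continuousOn_comp I).norm.mono hsub
    -- Nothing is known of `f` off the ball; the cut-off makes the function measurable on all of
    -- `ℂ`.
    set g : ℂ → ℝ := (Metric.ball w R).indicator (fun z => ‖f (sliceHom I z)‖) with hg
    have hgeq : ∀ z ∈ Metric.ball w R, g z = ‖f (sliceHom I z)‖ := fun z hz => by
      rw [hg, Set.indicator_of_mem hz]
    have hgm : Measurable g := by
      classical
      rw [hg, ← Set.piecewise_eq_indicator]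
      exact hc.measurable_piecewise continuousOn_const measurableSet_ball
    have h := area_submean (g := g) (w := w) (R := R)
      (fun z => Set.indicator_nonneg (fun _ _ => norm_nonneg _) z) hgm hR
      (hc.congr hgeq) (fun ρ hρ hρR => by
        have hcb := Metric.closedBall_subset_ball (x := w) hρR
        rw [hgeq w (Metric.mem_ball_self hR), Real.circleAverage_congr_sphere (f₂ :=
          fun z => ‖f (sliceHom I z)‖)]
        · exact hf.norm_le_circleAverage I hρ (hcb.trans hsub)
        · intro z hz
          rw [abs_of_pos hρ] at hz
          exact hgeq z (hcb (Metric.sphere_subset_closedBall hz)))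
    rw [hgeq w (Metric.mem_ball_self hR)] at h
    refine h.trans (le_of_eq (setLIntegral_congr_fun measurableSet_ball fun z hz => ?_))
    simp only [hgeq z hz]
  rcases le_total 1 p with h1 | h1
  · refine ⟨2 ^ p / Real.pi, by positivity, fun f hf I w R hR hsub => ?_⟩
    exact rpow_submean_of_one_le h1 (g := fun z => ‖f (sliceHom I z)‖) (fun _ => norm_nonneg _) hR
      (main f hf I w R hR (Metric.ball_subset_closedBall.trans hsub))
  · refine ⟨2 ^ (2 / p) / Real.pi, by positivity, fun f hf I w R hR hsub => ?_⟩
    exact rpow_submean_of_le_one hp h1 (g := fun z => ‖f (sliceHom I z)‖)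
      (fun _ => norm_nonneg _) hR ((hf.continuousOn_comp I).norm.mono hsub)
      (fun u ρ hρ hu => main f hf I u ρ hρ
        (hu.trans (Metric.ball_subset_closedBall.trans hsub)))

/-! ### From the disc bound to the Carleson inequality -/

/-- The Carleson estimate in the unit disc for functions with a local mean value estimate. -/
theorem lintegral_le_of_complexDisc_bound {r K : ℝ} (hr0 : 0 < r) (hr1 : r < 1) (hK : 0 ≤ K)
    {C : ℝ≥0} {m : Measure ℂ} [SFinite m]
    (hm : ∀ a ∈ Metric.ball (0 : ℂ) 1, m (complexDisc a r) ≤ C * volume (complexDisc a r))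
    {h : ℂ → ℝ≥0∞} (hh : Measurable h)
    (hloc : ∀ z ∈ Metric.ball (0 : ℂ) 1, h z * ENNReal.ofReal ((r / 4 * (1 - ‖z‖)) ^ 2) ≤
      ENNReal.ofReal K * ∫⁻ w in Metric.ball z (r / 4 * (1 - ‖z‖)), h w) :
    ∫⁻ z in Metric.ball 0 1, h z ∂m ≤
      ENNReal.ofReal (K * (64 / r ^ 2) * C * (Real.pi * (2 / (1 - r)) ^ 2)) *
        ∫⁻ w in Metric.ball 0 1, h w := by
  set S : Set (ℂ × ℂ) := {x | x.2 ∈ Metric.ball (0 : ℂ) 1 ∧ x.1 ∈ complexDisc x.2 r} with hS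
  have hSm : MeasurableSet S := by
    refine ((Metric.isOpen_ball.preimage continuous_snd).inter (isOpen_lt (f := fun x : ℂ × ℂ =>
      ‖x.1 - x.2‖) (g := fun x : ℂ × ℂ => r * ‖1 - x.1 * starRingEnd ℂ x.2‖) (by fun_prop)
      ?_)).measurableSet
    exact continuous_const.mul (continuous_const.sub
      (continuous_fst.mul (Complex.continuous_conj.comp continuous_snd))).norm
  -- The averaging radius is `R = r / 4 * (1 - |z|)`, and `1 - |w| ≤ 2 (1 - |z|)` for `w` in that
  -- disc, so `R^{-2} ≤ (64 / r²) (1 - |w|)^{-2}`. The weight now depends on `w` alone, and the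
  -- `z`-integral becomes a measure of a disc.
  set k : ℂ → ℝ≥0∞ := fun w => h w * ENNReal.ofReal (K * (64 / r ^ 2) * ((1 - ‖w‖) ^ 2)⁻¹)
    with hk
  have hkm : Measurable k := hh.mul (Measurable.ennreal_ofReal (by fun_prop))
  set Φ : ℂ → ℂ → ℝ≥0∞ := fun z w => S.indicator (fun x => k x.2) (z, w) with hΦ
  have hΦm : Measurable (Function.uncurry Φ) :=
    (hkm.comp measurable_snd).indicator hSm
  have step1 : ∀ z ∈ Metric.ball (0 : ℂ) 1, h z ≤ ∫⁻ w, Φ z w := by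
    intro z hz
    have hz1 : 0 < 1 - ‖z‖ := by linarith [mem_ball_zero_iff.1 hz]
    have hloc' := hloc z hz
    set R := r / 4 * (1 - ‖z‖) with hRd
    have hR : 0 < R := by positivity
    have hR2 : 0 < R ^ 2 := by positivity
    have h1 : h z ≤ (ENNReal.ofReal K * ∫⁻ w in Metric.ball z R, h w) / ENNReal.ofReal (R ^ 2) :=
      (ENNReal.le_div_iff_mul_le (Or.inl (by simpa using hR.ne')) (Or.inl ENNReal.ofReal_ne_top)).2
        hloc'
    refine h1.trans ?_
    rw [div_eq_mul_inv, mul_right_comm, ← ENNReal.ofReal_inv_of_pos hR2, ← ENNReal.ofReal_mul hK,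
      ← lintegral_const_mul' _ _ ENNReal.ofReal_ne_top, ← lintegral_indicator measurableSet_ball]
    refine lintegral_mono fun w => ?_
    by_cases hw : w ∈ Metric.ball z R
    · rw [Set.indicator_of_mem hw]
      obtain ⟨hw1, hzw, hcmp⟩ := norm_sub_lt_imp_mem_complexDisc (mem_ball_zero_iff.1 hz) hr0
        hr1.le (mem_ball_iff_norm.1 hw)
      have hmem : (z, w) ∈ S := ⟨mem_ball_zero_iff.2 hw1, hzw⟩
      simp only [hΦ, Set.indicator_of_mem hmem, hk]
      rw [mul_comm]
      refine mul_le_mul_right (ENNReal.ofReal_le_ofReal ?_) _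
      rw [mul_assoc]
      refine mul_le_mul_of_nonneg_left ?_ hK
      have hw2 : 0 < 1 - ‖w‖ := by linarith
      rw [← div_eq_mul_inv, le_div_iff₀ (by positivity), inv_mul_le_iff₀ hR2, hRd]
      have : (1 - ‖w‖) ^ 2 ≤ (2 * (1 - ‖z‖)) ^ 2 := by gcongr
      have e : (r / 4 * (1 - ‖z‖)) ^ 2 * (64 / r ^ 2) = (2 * (1 - ‖z‖)) ^ 2 := by
        field_simp
        ring
      rw [e]
      exact this
    · rw [Set.indicator_of_notMem hw]
      exact zero_le
  calc ∫⁻ z in Metric.ball 0 1, h z ∂m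
      ≤ ∫⁻ z in Metric.ball 0 1, (∫⁻ w, Φ z w) ∂m := setLIntegral_mono' measurableSet_ball step1
    _ ≤ ∫⁻ z, (∫⁻ w, Φ z w) ∂m := setLIntegral_le_lintegral _ _
    _ = ∫⁻ w, (∫⁻ z, Φ z w ∂m) := lintegral_lintegral_swap hΦm.aemeasurable
    _ ≤ ∫⁻ w, (Metric.ball (0 : ℂ) 1).indicator (fun w => ENNReal.ofReal
          (K * (64 / r ^ 2) * C * (Real.pi * (2 / (1 - r)) ^ 2)) * h w) w := by
        refine lintegral_mono fun w => ?_
        by_cases hw : w ∈ Metric.ball (0 : ℂ) 1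
        · rw [Set.indicator_of_mem hw]
          have hD : MeasurableSet (complexDisc w r) := by
            refine (isOpen_lt (f := fun x : ℂ => ‖x - w‖)
              (g := fun x : ℂ => r * ‖1 - x * starRingEnd ℂ w‖) (by fun_prop)
              (by fun_prop)).measurableSet
          have e : ∀ z, Φ z w = (complexDisc w r).indicator (fun _ => k w) z := by
            intro z
            by_cases hz : z ∈ complexDisc w r
            · rw [Set.indicator_of_mem hz]
              exact Set.indicator_of_mem (show (z, w) ∈ S from ⟨hw, hz⟩) _
            · rw [Set.indicator_of_notMem hz]
              exact Set.indicator_of_notMem (fun hc : (z, w) ∈ S => hz hc.2) _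
          have hw1 := mem_ball_zero_iff.1 hw
          have hw2 : 0 < 1 - ‖w‖ := by linarith
          simp only [e]
          rw [lintegral_indicator hD, setLIntegral_const, hk]
          -- The area is at most a constant times `(1 - |w|)²`, which cancels the weight in `k`.
          have hvol := (hm w hw).trans (mul_le_mul_right (volume_complexDisc_le hw1 hr1) _)
          rw [mul_assoc, mul_comm (ENNReal.ofReal (K * (64 / r ^ 2) * C * _))]
          gcongr
          refine (mul_le_mul_right hvol _).trans ?_
          rw [← ENNReal.ofReal_coe_nnreal, ← ENNReal.ofReal_mul (by positivity),
            ← ENNReal.ofReal_mul (by positivity)]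
          refine ENNReal.ofReal_le_ofReal (le_of_eq ?_)
          field_simp
        · rw [Set.indicator_of_notMem hw]
          have e : ∀ z, Φ z w = 0 := fun z =>
            Set.indicator_of_notMem (fun hc : (z, w) ∈ S => hw hc.1) _
          simp [e]
    _ = _ := by
        rw [lintegral_indicator measurableSet_ball, lintegral_const_mul _ hh]

theorem exists_carlesonBound_of_discBound {p : ℝ} (hp : 0 < p) {r : ℝ}
    (hr : r ∈ Set.Ioo (0 : ℝ) 1) (C : ℝ≥0) :
    ∃ C' : ℝ≥0, ∀ (I : imUnits) (m : Measure Quat), IsFiniteMeasure m →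
      DiscBoundOnSlice I m r C → CarlesonBoundOnSlice p I m C' := by
  obtain ⟨hr0, hr1⟩ := hr
  obtain ⟨K, hK, hsub⟩ := exists_rpow_submean hp
  refine ⟨(K * (64 / r ^ 2) * C * (Real.pi * (2 / (1 - r)) ^ 2)).toNNReal, ?_⟩
  intro I m hfin hdisc
  rw [discBoundOnSlice_iff] at hdisc
  rw [carlesonBoundOnSlice_iff hp]
  intro f hf
  -- Finiteness serves only to supply the s-finiteness needed for Tonelli.
  have hmf : IsFiniteMeasure (m.comap (sliceHom I)) :=
    ⟨by rw [(measurableEmbedding_sliceHom I).comap_apply]; exact measure_lt_top m _⟩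
  have hen : ∀ (J : imUnits) (w : ℂ),
      ‖f (sliceHom J w)‖ₑ ^ p = ENNReal.ofReal (‖f (sliceHom J w)‖ ^ p) := by
    intro J w
    rw [← ofReal_norm, ENNReal.ofReal_rpow_of_nonneg (norm_nonneg _) hp.le]
  have hc : ContinuousOn (fun w => ENNReal.ofReal (‖f (sliceHom I w)‖ ^ p))
      (Metric.ball (0 : ℂ) 1) :=
    ENNReal.continuous_ofReal.comp_continuousOn
      ((hf.1.continuousOn_comp I).norm.rpow_const fun _ _ => Or.inr hp.le)
  set h : ℂ → ℝ≥0∞ := (Metric.ball (0 : ℂ) 1).indicator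
    (fun w => ENNReal.ofReal (‖f (sliceHom I w)‖ ^ p)) with hh
  have hhm : Measurable h := by
    classical
    rw [hh, ← Set.piecewise_eq_indicator]
    exact hc.measurable_piecewise continuousOn_const measurableSet_ball
  have heq : ∀ w ∈ Metric.ball (0 : ℂ) 1, ‖f (sliceHom I w)‖ₑ ^ p = h w := fun w hw => by
    rw [hh, Set.indicator_of_mem hw, hen]
  have main := lintegral_le_of_complexDisc_bound hr0 hr1 hK hdisc hhm (fun z hz => by
    have hz1 : 0 < 1 - ‖z‖ := by linarith [mem_ball_zero_iff.1 hz]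
    have hcb : Metric.closedBall z (r / 4 * (1 - ‖z‖)) ⊆ Metric.ball 0 1 := by
      refine Metric.closedBall_subset_ball' ?_
      rw [dist_zero_right]
      nlinarith
    have h1 := hsub f hf.1 I z (r / 4 * (1 - ‖z‖)) (by positivity) hcb
    rw [ENNReal.ofReal_mul (by positivity), ← hen, heq z hz] at h1
    refine h1.trans (le_of_eq ?_)
    congr 1
    refine setLIntegral_congr_fun measurableSet_ball fun w hw => ?_
    rw [← hen, heq w (hcb (Metric.ball_subset_closedBall hw))])
  rw [setLIntegral_congr_fun measurableSet_ball heq]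
  refine main.trans ?_
  rw [← setLIntegral_congr_fun measurableSet_ball heq]
  -- The estimate takes place on the slice `I` alone; the supremum over slices only enlarges the
  -- right side.
  exact mul_le_mul_right (le_iSup
    (fun J : imUnits => ∫⁻ w in Metric.ball 0 1, ‖f (sliceHom J w)‖ₑ ^ p) I) _

theorem isFiniteMeasure_sliceMeasure {μ : Measure Quat} [IsFiniteMeasure μ]
    {ν : Measure imUnits} {κ : imUnits → Measure Quat} (hκ : IsSliceDisintegration μ ν κ)
    (I : imUnits) : IsFiniteMeasure (sliceMeasure μ κ I) := by
  have := hκ.prob_fiber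
  rw [sliceMeasure]
  infer_instance

end SliceBergman

theorem mainTheorem5 (p : ℝ) (hp : 0 < p) :
    (∀ (μ : Measure Quat) (_ : IsFiniteMeasure μ) (_ : μ unitBallᶜ = 0)
        (ν : Measure imUnits) (κ : imUnits → Measure Quat) (_ : IsSliceDisintegration μ ν κ),
      List.TFAE
        [IsSliceCarleson p μ κ,
         ∀ r ∈ Set.Ioo (0 : ℝ) 1, ∃ C : ℝ≥0, ∀ I : imUnits,
            DiscBoundOnSlice I (sliceMeasure μ κ I) r C,
         ∃ r ∈ Set.Ioo (0 : ℝ) 1, ∃ C : ℝ≥0, ∀ I : imUnits,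
            DiscBoundOnSlice I (sliceMeasure μ κ I) r C]) ∧
    (∀ (I : imUnits) (m : Measure Quat) (_ : IsFiniteMeasure m) (_ : m (sliceBall I)ᶜ = 0),
      List.TFAE
        [∃ C : ℝ≥0, CarlesonBoundOnSlice p I m C,
         ∀ r ∈ Set.Ioo (0 : ℝ) 1, ∃ C : ℝ≥0, DiscBoundOnSlice I m r C,
         ∃ r ∈ Set.Ioo (0 : ℝ) 1, ∃ C : ℝ≥0, DiscBoundOnSlice I m r C]) := by
  refine ⟨fun μ hμ _ ν κ hκ => ?_, fun I m hm _ => ?_⟩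
  · have hfin := fun I => isFiniteMeasure_sliceMeasure hκ I
    tfae_have 1 → 2 := by
      rintro ⟨C, hC⟩ r hr
      obtain ⟨C', hC'⟩ := exists_discBound_of_carlesonBound hp hr C
      exact ⟨C', fun I => hC' I _ (hC I)⟩
    tfae_have 2 → 3 := fun h => ⟨1 / 2, by norm_num, h _ (by norm_num)⟩
    tfae_have 3 → 1 := by
      rintro ⟨r, hr, C, hC⟩
      obtain ⟨C', hC'⟩ := exists_carlesonBound_of_discBound hp hr C
      exact ⟨C', fun I => hC' I _ (hfin I) (hC I)⟩
    tfae_finish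
  · tfae_have 1 → 2 := by
      rintro ⟨C, hC⟩ r hr
      obtain ⟨C', hC'⟩ := exists_discBound_of_carlesonBound hp hr C
      exact ⟨C', hC' I m hC⟩
    tfae_have 2 → 3 := fun h => ⟨1 / 2, by norm_num, h _ (by norm_num)⟩
    tfae_have 3 → 1 := by
      rintro ⟨r, hr, C, hC⟩
      obtain ⟨C', hC'⟩ := exists_carlesonBound_of_discBound hp hr C
      exact ⟨C', hC' I m hm hC⟩
    tfae_finish
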